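/- **Setting.** Let $E=(E^0,E^1,r,s)$ be a directed graph with countable vertex set $E^0$ and countable edge set $E^1$ that is row-finite ($r^{-1}(v)$ is finite for every $v\in E^0$) and has no sources ($r^{-1}(v)\neq\emptyset$ for every $v\in E^0$). Let $G$ be a countable discrete group with identity $e_G$, acting on $E$ by graph automorphisms, and let $\varphi\colon G\times E^1\to G$ satisfy $\varphi(gh,e)=\varphi(g,h\cdot e)\,\varphi(h,e)$ and $\varphi(g,e)\cdot v=g\cdot v$ for all $g,h\in G$, $e\in E^1$, $v\in E^0$. Let $R$ be a unital commutative $^*$-ring. **The algebra $L_R(G,E)$.** A $(G,E)$-family in a $^*$-algebra $A$ over $R$ consists of elements $P_{v,f},S_{e,g}\in A$ ($v\in E^0$, $e\in E^1$, $f,g\in G$) such that: (a) the $P_{v,e_G}$ are mutually orthogonal projections, the $S_{e,e_G}$ are partial isometries, $S_{e,e_G}^*S_{f,e_G}=\delta_{e,f}P_{s(e),e_G}$ for $e,f\in E^1$, and $P_{v,e_G}=\sum_{r(e)=v}S_{e,e_G}S_{e,e_G}^*$ for $v\in E^0$; (b) $P_{v,f}^*=P_{f^{-1}\cdot v,f^{-1}}$;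 (c) $P_{v,f}P_{w,h}=\delta_{v,f\cdot w}P_{v,fh}$; (d) $P_{v,f}S_{e,g}=\delta_{v,r(f\cdot e)}S_{f\cdot e,\varphi(f,e)g}$; (e) $S_{e,g}P_{v,f}=\delta_{g\cdot v,s(e)}S_{e,gf}$. Let $L_R(G,E)$ be the universal $^*$-algebra over $R$ generated by a $(G,E)$-family $\{p_{v,f},s_{e,g}\}$. **Paths.** Let $E^*$ be the set of finite paths $\alpha=e_1\cdots e_n$ with $s(e_i)=r(e_{i+1})$, including the vertices as paths of length $0$, and let $E^\infty$ be the set of infinite paths $e_1e_2\cdots$, with the topology inherited from the product of discrete spaces $\prod_{n\ge 1}E^1$. The action and $\varphi$ extend to $E^*$ by $\varphi(g,v)=g$ for $v\in E^0$, $g\cdot(e\mu)=(g\cdot e)(\varphi(g,e)\cdot\mu)$ and $\varphi(g,e\mu)=\varphi(\varphi(g,e),\mu)$, and the action extends to $E^\infty$ by the same formula. For $g\in G$ and $\alpha\in E^*$ put $s_{\alpha,g}=p_{\alpha,g}$ if $\alpha\in E^0$, and $s_{\alpha,g}=s_{e_1,e_G}\cdots s_{e_{n-1},e_G}s_{e_n,g}$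 if $\alpha=e_1\cdots e_n$ with $n\ge1$. **The groupoid.** Let $\mathcal S_{G,E}=\{(\alpha,g,\beta)\in E^*\times G\times E^*: s(\alpha)=g\cdot s(\beta)\}\cup\{0\}$, with zero $0$ and multiplication $$(\alpha,g,\beta)(\gamma,h,\delta)=\begin{cases}(\alpha\,(g\cdot\varepsilon),\ \varphi(g,\varepsilon)h,\ \delta)&\text{if }\gamma=\beta\varepsilon,\\ (\alpha,\ g\varphi(h^{-1},\varepsilon)^{-1},\ \delta\,(h^{-1}\cdot\varepsilon))&\text{if }\beta=\gamma\varepsilon,\\ 0&\text{otherwise.}\end{cases}$$ For $\beta\in E^*$ let $Z(\beta)\subseteq E^\infty$ be the set of infinite paths that begin with $\beta$ (those with range $\beta$, if $\beta\in E^0$); the element $(\alpha,g,\beta)$ acts as the map $Z(\beta)\to Z(\alpha)$, $\beta x\mapsto\alpha(g\cdot x)$. Let $\mathcal G_{\mathrm{tight}}(\mathcal S_{G,E})$ be the groupoid of germs of this action: its elements are the classes $[s,x]$ with $s=(\alpha,g,\beta)\in\mathcal S_{G,E}\setminus\{0\}$ and $x\in Z(\beta)$, where $[s,x]=[t,y]$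 if and only if $x=y$ and there is $\gamma\in E^*$ with $x\in Z(\gamma)$ and $s(\gamma,e_G,\gamma)=t(\gamma,e_G,\gamma)$. The source of $[s,x]$ is $x$, its range is $s\cdot x$, $[s,t\cdot x][t,x]=[st,x]$, and its topology is generated by the sets $\{[s,x]:x\in Z(\beta)\cap W\}$ with $s=(\alpha,g,\beta)$ and $W\subseteq E^\infty$ open. For $s=(\alpha,g,\beta)$ write $\Theta_s=\{[s,x]:x\in Z(\beta)\}$. A bisection is a set on which source and range are injective; products of subsets of the groupoid are $UV=\{ab: a\in U,\ b\in V,\ ab\text{ is defined}\}$. Let $\mathcal B$ be the set of compact open bisections of $\mathcal G_{\mathrm{tight}}(\mathcal S_{G,E})$; it contains every $\Theta_s$. The Steinberg algebra $A_R(\mathcal G_{\mathrm{tight}}(\mathcal S_{G,E}))$ is the $R$-linear span of the indicator functions $1_U\colon \mathcal G_{\mathrm{tight}}(\mathcal S_{G,E})\to R$ with $U\in\mathcal B$, with product $(fh)(c)=\sum_{ab=c}f(a)h(b)$ and involution $f^*(c)=f(c^{-1})^*$. **Theorem B (the Hausdorff case).** Suppose that $\mathcal G_{\mathrm{tight}}(\mathcal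 S_{G,E})$ is Hausdorff. Then there is a unique $^*$-homomorphism $$\pi_{G,E}\colon L_R(G,E)\to A_R(\mathcal G_{\mathrm{tight}}(\mathcal S_{G,E}))$$ such that $\pi_{G,E}(p_{v,f})=1_{\Theta_{(v,f,f^{-1}\cdot v)}}$ and $\pi_{G,E}(s_{e,g})=1_{\Theta_{(e,g,g^{-1}\cdot s(e))}}$ for all $v\in E^0$, $e\in E^1$, $f,g\in G$, and $\pi_{G,E}$ is a $^*$-isomorphism. Moreover, there is a family $\{t_U\}_{U\in\mathcal B}$ in $L_R(G,E)$ such that 1. $t_\emptyset=0$; $t_Ut_V=t_{UV}$ for all $U,V\in\mathcal B$; and $t_U+t_V=t_{U\cup V}$ whenever $U,V\in\mathcal B$ are disjoint and $U\cup V\in\mathcal B$; 2. $t_U=\sum_{(\alpha,g,\beta)\in J}s_{\alpha,g}s_{\beta,e_G}^*$ whenever $U\in\mathcal B$ is the disjoint union of the sets $\Theta_s$, $s\in J$, for a finite set $J\subseteq\mathcal S_{G,E}\setminus\{0\}$; 3. $\pi_{G,E}^{-1}(1_U)=t_U$ for every $U\in\mathcal B$. -/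

import Mathlib

namespace ExelPardo

/-- A self-similar action `(G, E, φ)`: `E` is the directed graph with vertex set `V`, edge set `Ed`
and range and source maps `rng`, `src`; it is row-finite and has no sources. The group `G` acts on
`E` by graph automorphisms, and `φ` is a one-cocycle for the action on the edges. -/
structure SelfSimilarGraph (G V Ed : Type*) [Group G] [MulAction G V] [MulAction G Ed] where
  rng : Ed → V
  src : Ed → V
  row_finite : ∀ v : V, {e : Ed | rng e = v}.Finite
  no_sources : ∀ v : V, ∃ e : Ed, rng e = v
  rng_smul : ∀ (g : G) (e : Ed), rng (g • e) = g • rng e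
  src_smul : ∀ (g : G) (e : Ed), src (g • e) = g • src e
  φ : G → Ed → G
  φ_mul : ∀ (g h : G) (e : Ed), φ (g * h) e = φ g (h • e) * φ h e
  φ_smul : ∀ (g : G) (e : Ed) (v : V), φ g e • v = g • v

section

variable {G V Ed : Type*} [Group G] [MulAction G V] [MulAction G Ed]
  (D : SelfSimilarGraph G V Ed)

namespace SelfSimilarGraph

/-- `D.IsPath v [e₁, …, eₙ]`: the list is a path with range `v`, read from the range, that is
`rng e₁ = v` and `src eᵢ = rng eᵢ₊₁`. -/
def IsPath : V → List Ed → Prop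
  | _, [] => True
  | v, e :: l => D.rng e = v ∧ IsPath (D.src e) l

/-- The source of the path `[e₁, …, eₙ]` with range `v`: it is `src eₙ`, and `v` if `n = 0`. -/
def endpoint : V → List Ed → V
  | v, [] => v
  | _, e :: l => endpoint (D.src e) l

/-- The action on sequences of edges: `g · (eμ) = (g · e)(φ(g, e) · μ)`. -/
def actL : G → List Ed → List Ed
  | _, [] => []
  | g, e :: l => g • e :: actL (D.φ g e) l

/-- The cocycle on sequences of edges: `φ(g, eμ) = φ(φ(g, e), μ)`. -/
def cocL : G → List Ed → G
  | g, [] => g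
  | g, e :: l => cocL (D.φ g e) l

/-- The action on infinite sequences of edges: the `n`-th entry of `g · (e₀e₁e₂…)` is
`φ(g, e₀…eₙ₋₁) · eₙ`. -/
def actS (g : G) (σ : Stream' Ed) : Stream' Ed := fun n => D.cocL g (σ.take n) • σ.get n

theorem φ_one (e : Ed) : D.φ 1 e = 1 := by
  have h := D.φ_mul 1 1 e
  simpa using h

theorem isPath_append (l m : List Ed) (v : V) :
    D.IsPath v (l ++ m) ↔ D.IsPath v l ∧ D.IsPath (D.endpoint v l) m := by
  induction l generalizing v with
  | nil => simp [IsPath, endpoint]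
  | cons e l ih => simp [IsPath, endpoint, ih, and_assoc]

theorem endpoint_append (l m : List Ed) (v : V) :
    D.endpoint v (l ++ m) = D.endpoint (D.endpoint v l) m := by
  induction l generalizing v with
  | nil => simp [endpoint]
  | cons e l ih => simp [endpoint, ih]

@[simp] theorem length_actL (g : G) (l : List Ed) : (D.actL g l).length = l.length := by
  induction l generalizing g with
  | nil => simp [actL]
  | cons e l ih => simp [actL, ih]

theorem actL_append (g : G) (l m : List Ed) :
    D.actL g (l ++ m) = D.actL g l ++ D.actL (D.cocL g l) m := by
  induction l generalizing g with
  | nil => simp [actL, cocL]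
  | cons e l ih => simp [actL, cocL, ih]

theorem cocL_append (g : G) (l m : List Ed) :
    D.cocL g (l ++ m) = D.cocL (D.cocL g l) m := by
  induction l generalizing g with
  | nil => simp [cocL]
  | cons e l ih => simp [cocL, ih]

@[simp] theorem actL_one (l : List Ed) : D.actL 1 l = l := by
  induction l with
  | nil => simp [actL]
  | cons e l ih => simp [actL, φ_one, ih]

@[simp] theorem cocL_one (l : List Ed) : D.cocL 1 l = 1 := by
  induction l with
  | nil => simp [cocL]
  | cons e l ih => simp [cocL, φ_one, ih]

theorem actL_mul (g h : G) (l : List Ed) : D.actL (g * h) l = D.actL g (D.actL h l) := by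
  induction l generalizing g h with
  | nil => simp [actL]
  | cons e l ih => simp [actL, φ_mul, ih, mul_smul]

theorem cocL_mul (g h : G) (l : List Ed) :
    D.cocL (g * h) l = D.cocL g (D.actL h l) * D.cocL h l := by
  induction l generalizing g h with
  | nil => simp [actL, cocL]
  | cons e l ih => simp [actL, cocL, φ_mul, ih]

theorem cocL_smul (g : G) (l : List Ed) (v : V) : D.cocL g l • v = g • v := by
  induction l generalizing g with
  | nil => simp [cocL]
  | cons e l ih => simp [cocL, ih, D.φ_smul]

theorem isPath_act (g : G) (l : List Ed) (v : V) (h : D.IsPath v l) :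
    D.IsPath (g • v) (D.actL g l) := by
  induction l generalizing g v with
  | nil => simp [IsPath, actL]
  | cons e l ih =>
    refine ⟨by rw [D.rng_smul, h.1], ?_⟩
    rw [D.src_smul, ← D.φ_smul g e]
    exact ih _ _ h.2

theorem endpoint_act (g : G) (l : List Ed) (v : V) :
    D.endpoint (g • v) (D.actL g l) = g • D.endpoint v l := by
  induction l generalizing g v with
  | nil => simp [endpoint, actL]
  | cons e l ih =>
    simp only [endpoint, actL]
    rw [D.src_smul, ← D.φ_smul g e, ih, D.φ_smul]

theorem take_actS (g : G) (σ : Stream' Ed) (n : ℕ) :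
    (D.actS g σ).take n = D.actL g (σ.take n) := by
  induction n with
  | zero => simp [actL]
  | succ n ih => 
    rw [Stream'.take_succ', Stream'.take_succ', actL_append, ih]
    rfl

theorem drop_actS (g : G) (σ : Stream' Ed) (n : ℕ) :
    (D.actS g σ).drop n = D.actS (D.cocL g (σ.take n)) (σ.drop n) := by
  ext k
  rw [Stream'.get_drop]
  change D.cocL g (σ.take (n + k)) • σ.get (n + k) =
    D.cocL (D.cocL g (σ.take n)) ((σ.drop n).take k) • (σ.drop n).get k
  rw [Stream'.take_add, cocL_append, Stream'.get_drop]

theorem take_append (l : List Ed) (σ : Stream' Ed) : (l ++ₛ σ).take l.length = l := by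
  rw [Stream'.take_append_of_le_length (h := le_rfl), List.take_length]

theorem actS_append (g : G) (l : List Ed) (σ : Stream' Ed) :
    D.actS g (l ++ₛ σ) = D.actL g l ++ₛ D.actS (D.cocL g l) σ := by
  rw [← Stream'.append_take_drop l.length (D.actS g (l ++ₛ σ)), take_actS, drop_actS,
    take_append, Stream'.drop_append_stream]

theorem actS_mul (g h : G) (σ : Stream' Ed) : D.actS (g * h) σ = D.actS g (D.actS h σ) := by
  apply Stream'.take_theorem
  intro n
  simp only [take_actS, actL_mul]

@[simp] theorem actS_one (σ : Stream' Ed) : D.actS 1 σ = σ := by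
  apply Stream'.take_theorem
  intro n
  simp only [take_actS, actL_one]

theorem isPath_take {σ : Stream' Ed} (h : ∀ n, D.src (σ.get n) = D.rng (σ.get (n + 1))) (n : ℕ) :
    D.IsPath (D.rng (σ.get 0)) (σ.take n) ∧
      D.endpoint (D.rng (σ.get 0)) (σ.take n) = D.rng (σ.get n) := by
  induction n with
  | zero => simp [IsPath, endpoint]
  | succ n ih =>
    rw [Stream'.take_succ', isPath_append, endpoint_append, ih.2]
    exact ⟨⟨ih.1, rfl, trivial⟩, h n⟩

theorem chain_of_isPath {σ : Stream' Ed} {v : V} (h : ∀ n, D.IsPath v (σ.take n)) :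
    D.rng (σ.get 0) = v ∧ ∀ n, D.src (σ.get n) = D.rng (σ.get (n + 1)) := by
  refine ⟨(h 1).1, fun n => ?_⟩
  have h2 := h (n + 1 + 1)
  rw [Stream'.take_succ', Stream'.take_succ', List.append_assoc, isPath_append] at h2
  exact h2.2.2.1.symm

end SelfSimilarGraph

open SelfSimilarGraph

/-- A finite path of `E` (an element of `E^*`): its range together with its edges. The paths of
length `0` are the vertices. -/
@[ext] structure FinPath where
  r : V
  edges : List Ed
  isPath : D.IsPath r edges

/-- An infinite path `e₀e₁e₂…` of `E` (an element of `E^∞`), so `src eₙ = rng eₙ₊₁`. -/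
@[ext] structure InfPath where
  seq : Stream' Ed
  chain : ∀ n, D.src (seq.get n) = D.rng (seq.get (n + 1))

variable {D}

namespace FinPath

/-- The source of a finite path. -/
def s (α : FinPath D) : V := D.endpoint α.r α.edges

/-- The length `|α|`. -/
def length (α : FinPath D) : ℕ := α.edges.length

/-- The vertex `v` as a path of length `0`. -/
def vertex (D : SelfSimilarGraph G V Ed) (v : V) : FinPath D := ⟨v, [], trivial⟩

/-- The edge `e` as a path of length `1`. -/
def edge (D : SelfSimilarGraph G V Ed) (e : Ed) : FinPath D := ⟨D.rng e, [e], rfl, trivial⟩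

/-- The concatenation `αε`, defined if `s(α) = r(ε)`. -/
def append (α ε : FinPath D) (h : α.s = ε.r) : FinPath D :=
  ⟨α.r, α.edges ++ ε.edges, (D.isPath_append _ _ _).2 ⟨α.isPath, by
    have := ε.isPath
    rwa [← h] at this⟩⟩

/-- The action of `G` on `E^*`. -/
def act (g : G) (α : FinPath D) : FinPath D :=
  ⟨g • α.r, D.actL g α.edges, D.isPath_act _ _ _ α.isPath⟩

/-- The cocycle `φ : G × E^* → G`; in particular `φ(g, v) = g` for a vertex `v`. -/
def coc (g : G) (α : FinPath D) : G := D.cocL g α.edges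

theorem s_append (α ε : FinPath D) (h : α.s = ε.r) : (α.append ε h).s = ε.s := by
  unfold s at h ⊢
  simp only [append, endpoint_append, h]

theorem s_act (g : G) (α : FinPath D) : (α.act g).s = g • α.s := D.endpoint_act _ _ _

theorem coc_smul (g : G) (α : FinPath D) (v : V) : α.coc g • v = g • v := D.cocL_smul _ _ _

end FinPath

namespace InfPath

/-- The range of an infinite path. -/
def r (x : InfPath D) : V := D.rng (x.seq.get 0)

/-- The finite path consisting of the first `n` edges of `x`. -/
def pre (x : InfPath D) (n : ℕ) : FinPath D := ⟨x.r, x.seq.take n, (D.isPath_take x.chain n).1⟩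

/-- The infinite path obtained from `x` by removing its first `n` edges. -/
def drop (x : InfPath D) (n : ℕ) : InfPath D := ⟨x.seq.drop n, fun k => by
  simpa only [Stream'.get_drop, Nat.add_assoc] using x.chain (n + k)⟩

theorem act_chain (g : G) (x : InfPath D) : D.rng ((D.actS g x.seq).get 0) = g • x.r ∧
    ∀ n, D.src ((D.actS g x.seq).get n) = D.rng ((D.actS g x.seq).get (n + 1)) :=
  D.chain_of_isPath fun n => by
    rw [take_actS]
    exact D.isPath_act _ _ _ (D.isPath_take x.chain n).1

/-- The action of `G` on `E^∞`: `g · x` is the infinite path whose initial segments are the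
paths `g · (e₀…eₙ)`. -/
def act (g : G) (x : InfPath D) : InfPath D := ⟨D.actS g x.seq, (x.act_chain g).2⟩

theorem r_act (g : G) (x : InfPath D) : (x.act g).r = g • x.r := (x.act_chain g).1

theorem ext_take_drop {x y : InfPath D} (m : ℕ) (h1 : x.seq.take m = y.seq.take m)
    (h2 : x.drop m = y.drop m) : x = y := by
  ext1
  rw [← Stream'.append_take_drop m x.seq, h1]
  exact (congrArg (_ ++ₛ ·) (congrArg InfPath.seq h2)).trans (Stream'.append_take_drop m y.seq)

theorem r_drop (x : InfPath D) (n : ℕ) : (x.drop n).r = (x.pre n).s := by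
  refine Eq.trans ?_ (D.isPath_take x.chain n).2.symm
  simp only [r, drop, Stream'.get_drop, Nat.add_zero]

end InfPath

namespace FinPath

theorem concat_chain (α : FinPath D) (y : InfPath D) (h : α.s = y.r) :
    D.rng ((α.edges ++ₛ y.seq).get 0) = α.r ∧
    ∀ n, D.src ((α.edges ++ₛ y.seq).get n) = D.rng ((α.edges ++ₛ y.seq).get (n + 1)) :=
  D.chain_of_isPath fun n => by
    rcases le_total n α.edges.length with hn | hn
    · rw [Stream'.take_append_of_le_length (h := hn)]
      have := α.isPath
      rw [← List.take_append_drop n α.edges, isPath_append] at this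
      exact this.1
    · obtain ⟨k, rfl⟩ := Nat.exists_eq_add_of_le hn
      rw [← Stream'.append_take, isPath_append]
      refine ⟨α.isPath, ?_⟩
      have := (y.pre k).isPath
      change D.IsPath y.r _ at this
      rwa [← h] at this

/-- The concatenation `αy` of a finite and an infinite path, defined if `s(α) = r(y)`. -/
def concat (α : FinPath D) (y : InfPath D) (h : α.s = y.r) : InfPath D :=
  ⟨α.edges ++ₛ y.seq, (α.concat_chain y h).2⟩

theorem r_concat (α : FinPath D) (y : InfPath D) (h : α.s = y.r) : (α.concat y h).r = α.r :=
  (α.concat_chain y h).1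

/-- The cylinder set `Z(β) = {βy : y ∈ E^∞, r(y) = s(β)}`. -/
def Z (β : FinPath D) : Set (InfPath D) := {x | ∃ (y : InfPath D) (h : β.s = y.r), x = β.concat y h}

theorem mem_Z (β : FinPath D) (x : InfPath D) :
    x ∈ β.Z ↔ x.r = β.r ∧ x.seq.take β.edges.length = β.edges := by
  constructor
  · rintro ⟨y, h, rfl⟩
    exact ⟨β.r_concat y h, take_append _ _⟩
  · rintro ⟨h1, h2⟩
    have h3 : β = x.pre β.edges.length := FinPath.ext h1.symm h2.symm
    refine ⟨x.drop β.edges.length, by rw [InfPath.r_drop, ← h3], ?_⟩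
    ext1
    change x.seq = β.edges ++ₛ x.seq.drop β.edges.length
    conv_rhs => rw [← h2, Stream'.length_take, Stream'.append_take_drop]

theorem eq_pre {β : FinPath D} {x : InfPath D} (h : x ∈ β.Z) : β = x.pre β.length :=
  FinPath.ext ((β.mem_Z x).1 h).1.symm ((β.mem_Z x).1 h).2.symm

end FinPath

theorem FinPath.edges_eq {β : FinPath D} {x : InfPath D} (h : x ∈ β.Z) :
    β.edges = x.seq.take β.length := ((β.mem_Z x).1 h).2.symm

theorem FinPath.r_eq {β : FinPath D} {x : InfPath D} (h : x ∈ β.Z) : β.r = x.r :=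
  ((β.mem_Z x).1 h).1.symm

theorem InfPath.mem_Z_pre (x : InfPath D) (n : ℕ) : x ∈ (x.pre n).Z :=
  (FinPath.mem_Z _ _).2 ⟨rfl, by simp [pre]⟩

variable (D) in
/-- The nonzero elements `(α, g, β)` of `S_{G,E}`: here `s(α) = g · s(β)`. -/
@[ext] structure Triple where
  a : FinPath D
  g : G
  b : FinPath D
  h : a.s = g • b.s

variable (D) in
/-- The inverse semigroup `S_{G,E}`: the triples `(α, g, β)` together with a zero element. -/
inductive SGE where
  | zero : SGE
  | of (s : Triple D) : SGE

namespace Triple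

/-- The adjoint `(α, g, β)^* = (β, g⁻¹, α)`. -/
def adj (s : Triple D) : Triple D := ⟨s.b, s.g⁻¹, s.a, by rw [s.h, inv_smul_smul]⟩

open Classical in
/-- The product of `S_{G,E}`:
`(α, g, β)(γ, h, δ) = (α(g·ε), φ(g, ε)h, δ)` if `γ = βε`,
`(α, g, β)(γ, h, δ) = (α, gφ(h⁻¹, ε)⁻¹, δ(h⁻¹·ε))` if `β = γε`, and it is `0` otherwise. -/
noncomputable def mul (s t : Triple D) : SGE D :=
  if H : ∃ (ε : FinPath D) (hε : s.b.s = ε.r), t.a = s.b.append ε hε then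
    .of
      { a := s.a.append (H.choose.act s.g) (by
          rw [s.h]; exact congrArg (s.g • ·) H.choose_spec.choose)
        g := H.choose.coc s.g * t.g
        b := t.b
        h := by
          rw [FinPath.s_append, FinPath.s_act, mul_smul, ← t.h, FinPath.coc_smul]
          conv_rhs => rw [H.choose_spec.choose_spec, FinPath.s_append] }
  else if H : ∃ (ε : FinPath D) (hε : t.a.s = ε.r), s.b = t.a.append ε hε then
    .of
      { a := s.a
        g := s.g * (H.choose.coc t.g⁻¹)⁻¹
        b := t.b.append (H.choose.act t.g⁻¹) (by
          change t.b.s = t.g⁻¹ • H.choose.r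
          rw [← H.choose_spec.choose, t.h, inv_smul_smul])
        h := by
          rw [FinPath.s_append, FinPath.s_act, mul_smul, ← FinPath.coc_smul t.g⁻¹ H.choose,
            inv_smul_smul, s.h]
          conv_lhs => rw [H.choose_spec.choose_spec, FinPath.s_append] }
  else .zero

/-- The idempotent `(γ, e_G, γ)`. -/
def idem (γ : FinPath D) : Triple D := ⟨γ, 1, γ, (one_smul G _).symm⟩

theorem act_aux (s : Triple D) {x : InfPath D} (hx : x ∈ s.b.Z) :
    s.a.s = ((x.drop s.b.length).act s.g).r := by
  rw [InfPath.r_act, InfPath.r_drop, ← FinPath.eq_pre hx, s.h]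

/-- The action of `s = (α, g, β)` on `Z(β)`: `s · (βy) = α(g · y)`. -/
def act (s : Triple D) (x : InfPath D) (hx : x ∈ s.b.Z) : InfPath D :=
  s.a.concat ((x.drop s.b.length).act s.g) (s.act_aux hx)

end Triple

/-- The product of `S_{G,E}`. -/
noncomputable instance : Mul (SGE D) := ⟨fun
  | .of s, .of t => s.mul t
  | _, _ => .zero⟩

/-- The adjoint of `S_{G,E}`. -/
instance : Star (SGE D) := ⟨fun
  | .of s => .of s.adj
  | .zero => .zero⟩

/-- A pair `(s, x)` with `0 ≠ s = (α, g, β) ∈ S_{G,E}` and `x ∈ Z(β)`. -/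
structure PreGerm (D : SelfSimilarGraph G V Ed) where
  s : Triple D
  x : InfPath D
  hx : x ∈ s.b.Z

/-- `(s, x)` and `(t, y)` have the same germ if `x = y` and `se = te` for some idempotent
`e = (γ, e_G, γ)` with `x ∈ Z(γ)`. -/
def PreGerm.Rel (p q : PreGerm D) : Prop :=
  p.x = q.x ∧ ∃ γ : FinPath D, p.x ∈ γ.Z ∧
    SGE.of p.s * SGE.of (Triple.idem γ) = SGE.of q.s * SGE.of (Triple.idem γ)

namespace Triple

theorem mul_of_append {s t : Triple D} {w : List Ed} (hr : t.a.r = s.b.r)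
    (he : t.a.edges = s.b.edges ++ w) :
    ∃ u : Triple D, SGE.of s * SGE.of t = SGE.of u ∧ u.a.r = s.a.r ∧
      u.a.edges = s.a.edges ++ D.actL s.g w ∧ u.g = D.cocL s.g w * t.g ∧ u.b = t.b := by
  have hw := t.a.isPath
  rw [he, hr, isPath_append] at hw
  have H : ∃ (ε : FinPath D) (hε : s.b.s = ε.r), t.a = s.b.append ε hε :=
    ⟨⟨s.b.s, w, hw.2⟩, rfl, FinPath.ext hr he⟩
  have hw' : H.choose.edges = w := by
    have h1 := congrArg FinPath.edges H.choose_spec.choose_spec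
    rw [he] at h1
    exact (List.append_cancel_left h1).symm
  refine ⟨_, dif_pos H, rfl, ?_, ?_, rfl⟩
  · change s.a.edges ++ D.actL s.g H.choose.edges = _
    rw [hw']
  · change D.cocL s.g H.choose.edges * t.g = _
    rw [hw']

theorem mul_of_append' {s t : Triple D} {w : List Ed} (hr : s.b.r = t.a.r)
    (he : s.b.edges = t.a.edges ++ w) :
    ∃ u : Triple D, SGE.of s * SGE.of t = SGE.of u ∧ u.a = s.a ∧
      u.g = s.g * (D.cocL t.g⁻¹ w)⁻¹ ∧ u.b.r = t.b.r ∧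
      u.b.edges = t.b.edges ++ D.actL t.g⁻¹ w := by
  by_cases hn : w = []
  · subst hn
    obtain ⟨u, h1, h2, h3, h4, h5⟩ := mul_of_append (s := s) (t := t) (w := []) hr.symm
      (by rw [he]; simp)
    refine ⟨u, h1, FinPath.ext h2 (by simpa [actL] using h3), by simpa [cocL] using h4,
      by rw [h5], by simp [h5, actL]⟩
  · have hw := s.b.isPath
    rw [he, hr, isPath_append] at hw
    have H : ∃ (ε : FinPath D) (hε : t.a.s = ε.r), s.b = t.a.append ε hε :=
      ⟨⟨t.a.s, w, hw.2⟩, rfl, FinPath.ext hr he⟩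
    have hw' : H.choose.edges = w := by
      have h1 := congrArg FinPath.edges H.choose_spec.choose_spec
      rw [he] at h1
      exact (List.append_cancel_left h1).symm
    have H' : ¬ ∃ (ε : FinPath D) (hε : s.b.s = ε.r), t.a = s.b.append ε hε := by
      rintro ⟨ε, hε, h⟩
      have h1 := congrArg (fun p => p.edges.length) h
      have h2 := congrArg List.length he
      simp only [FinPath.append, List.length_append] at h1 h2
      exact hn (List.length_eq_zero_iff.1 (by omega))
    refine ⟨_, (dif_neg H').trans (dif_pos H), rfl, ?_, rfl, ?_⟩
    · change s.g * (D.cocL t.g⁻¹ H.choose.edges)⁻¹ = _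
      rw [hw']
    · change t.b.edges ++ D.actL t.g⁻¹ H.choose.edges = _
      rw [hw']

end Triple

namespace PreGerm

/-- The point `s · x`. -/
def tgt (p : PreGerm D) : InfPath D := p.s.act p.x p.hx

/-- Auxiliary: `se = (y₁…yₘ, g, x₁…xₙ)` for some idempotent `e`, where `y = s · x`. -/
def Data (p : PreGerm D) (n m : ℕ) (g : G) : Prop :=
  ∃ k, n = p.s.b.length + k ∧ m = p.s.a.length + k ∧
    g = D.cocL p.s.g ((p.x.seq.drop p.s.b.length).take k)

theorem Data.unique {p : PreGerm D} {n m m' : ℕ} {g g' : G} (h : p.Data n m g)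
    (h' : p.Data n m' g') : m = m' ∧ g = g' := by
  obtain ⟨k, h1, h2, h3⟩ := h
  obtain ⟨k', h1', h2', h3'⟩ := h'
  obtain rfl : k = k' := by omega
  exact ⟨by omega, by rw [h3, h3']⟩

theorem Data.shift {p : PreGerm D} {n m : ℕ} {g : G} (h : p.Data n m g) (j : ℕ) :
    p.Data (n + j) (m + j) (D.cocL g ((p.x.seq.drop n).take j)) := by
  obtain ⟨k, h1, h2, h3⟩ := h
  refine ⟨k + j, by omega, by omega, ?_⟩
  rw [Stream'.take_add, cocL_append, ← h3, Stream'.drop_drop, h1]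

theorem data_self (p : PreGerm D) : p.Data p.s.b.length p.s.a.length p.s.g :=
  ⟨0, rfl, rfl, rfl⟩

theorem Data.drop_tgt {p : PreGerm D} {n m : ℕ} {g : G} (h : p.Data n m g) :
    p.tgt.drop m = (p.x.drop n).act g := by
  obtain ⟨k, rfl, rfl, rfl⟩ := h
  ext1
  change (p.s.a.edges ++ₛ D.actS p.s.g (p.x.seq.drop p.s.b.length)).drop _ =
    D.actS _ (p.x.seq.drop (p.s.b.length + k))
  rw [← Stream'.drop_drop, ← Stream'.drop_drop]
  unfold FinPath.length
  rw [Stream'.drop_append_stream, drop_actS]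

theorem take_tgt {p : PreGerm D} (k : ℕ) : p.tgt.seq.take (p.s.a.length + k) =
    p.s.a.edges ++ D.actL p.s.g ((p.x.seq.drop p.s.b.length).take k) := by
  change (p.s.a.edges ++ₛ D.actS p.s.g (p.x.seq.drop p.s.b.length)).take _ = _
  unfold FinPath.length
  rw [← Stream'.append_take, take_actS]

theorem r_tgt (p : PreGerm D) : p.tgt.r = p.s.a.r :=
  FinPath.r_concat _ _ (p.s.act_aux p.hx)

theorem mem_Z_tgt (p : PreGerm D) : p.tgt ∈ p.s.a.Z :=
  ⟨_, p.s.act_aux p.hx, rfl⟩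

theorem Data.s_eq {p : PreGerm D} {n m : ℕ} {g : G} (h : p.Data n m g) :
    (p.tgt.pre m).s = g • (p.x.pre n).s := by
  rw [← InfPath.r_drop, h.drop_tgt, InfPath.r_act, InfPath.r_drop]

theorem mul_idem (p : PreGerm D) (N : ℕ) : ∃ (n m : ℕ) (g : G) (h : p.Data n m g),
    n = max p.s.b.length N ∧ SGE.of p.s * SGE.of (Triple.idem (p.x.pre N)) =
      SGE.of ⟨p.tgt.pre m, g, p.x.pre n, h.s_eq⟩ := by
  have hb := FinPath.eq_pre p.hx
  rcases le_total p.s.b.length N with hN | hN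
  · obtain ⟨k, rfl⟩ := Nat.exists_eq_add_of_le hN
    refine ⟨p.s.b.length + k, p.s.a.length + k, _, ⟨k, rfl, rfl, rfl⟩, by omega, ?_⟩
    obtain ⟨u, h1, h2, h3, h4, h5⟩ := Triple.mul_of_append (s := p.s)
      (t := Triple.idem (p.x.pre (p.s.b.length + k)))
      (w := (p.x.seq.drop p.s.b.length).take k)
      (FinPath.r_eq p.hx).symm
      (by rw [FinPath.edges_eq p.hx]
          exact Stream'.take_add _ _ _)
    rw [h1]
    congr 1
    refine Triple.ext (FinPath.ext ?_ ?_) ?_ h5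
    · rw [h2]; exact (r_tgt p).symm
    · rw [h3]; exact (take_tgt k).symm
    · rw [h4]; exact mul_one _
  · obtain ⟨k, hk⟩ := Nat.exists_eq_add_of_le hN
    refine ⟨_, _, _, p.data_self, by omega, ?_⟩
    have hb2 : p.s.b.edges = (p.x.pre N).edges ++ (p.x.seq.drop N).take k := by
      rw [FinPath.edges_eq p.hx, hk]; exact Stream'.take_add _ _ _
    obtain ⟨u, h1, h2, h3, h4, h5⟩ := Triple.mul_of_append' (s := p.s)
      (t := Triple.idem (p.x.pre N)) (w := (p.x.seq.drop N).take k)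
      (FinPath.r_eq p.hx) hb2
    rw [h1]
    congr 1
    refine Triple.ext ?_ ?_ ?_
    · rw [h2]; exact FinPath.eq_pre p.mem_Z_tgt
    · rw [h3]
      simp [Triple.idem]
    · refine Eq.trans (FinPath.ext (h4.trans ?_) (h5.trans ?_)) hb
      · exact (FinPath.r_eq p.hx).symm
      · rw [hb2]; simp [Triple.idem]

theorem rel_iff (p q : PreGerm D) : p.Rel q ↔
    p.x = q.x ∧ p.tgt = q.tgt ∧ ∃ n m g, p.Data n m g ∧ q.Data n m g := by
  constructor
  · rintro ⟨hx, γ, hγ, h⟩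
    obtain ⟨s, x, hs⟩ := p
    obtain ⟨t, x', ht⟩ := q
    obtain rfl : x = x' := hx
    set p : PreGerm D := ⟨s, x, hs⟩
    set q : PreGerm D := ⟨t, x, ht⟩
    have hx : p.x = q.x := rfl
    rw [FinPath.eq_pre hγ] at h
    obtain ⟨n, m, g, hd, -, h1⟩ := p.mul_idem γ.length
    rw [h1] at h
    obtain ⟨n', m', g', hd', -, h1'⟩ := q.mul_idem γ.length
    replace h := h.trans h1'
    injection h with h
    have e1 := congrArg (fun t => t.a.edges.length) h
    have e2 := congrArg (fun t => t.b.edges.length) h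
    have e3 := congrArg (fun t => t.g) h
    have e4 := congrArg (fun t => t.a.edges) h
    simp only [InfPath.pre, Stream'.length_take] at e1 e2 e3 e4
    subst e1 e2 e3
    refine ⟨hx, ?_, n, m, g, hd, hd'⟩
    ext1
    rw [← Stream'.append_take_drop m p.tgt.seq, ← Stream'.append_take_drop m q.tgt.seq, e4]
    have := hd.drop_tgt.trans ((congrArg (fun x => (x.drop n).act g) hx).trans hd'.drop_tgt.symm)
    exact congrArg (_ ++ₛ ·) (congrArg InfPath.seq this)
  · rintro ⟨hx, hy, n, m, g, hd, hd'⟩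
    obtain ⟨s, x, hs⟩ := p
    obtain ⟨t, x', ht⟩ := q
    obtain rfl : x = x' := hx
    set p : PreGerm D := ⟨s, x, hs⟩
    set q : PreGerm D := ⟨t, x, ht⟩
    have hx : p.x = q.x := rfl
    refine ⟨hx, p.x.pre n, p.x.mem_Z_pre n, ?_⟩
    obtain ⟨n1, m1, g1, hd1, e1, h1⟩ := p.mul_idem n
    obtain ⟨n2, m2, g2, hd2, e2, h2⟩ := q.mul_idem n
    have l1 : p.s.b.length ≤ n := by obtain ⟨k, h, -⟩ := hd; omega
    have l2 : q.s.b.length ≤ n := by obtain ⟨k, h, -⟩ := hd'; omega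
    obtain rfl : n1 = n := by omega
    obtain rfl : n2 = n1 := by omega
    obtain ⟨rfl, rfl⟩ := hd1.unique hd
    obtain ⟨rfl, rfl⟩ := hd2.unique hd'
    refine h1.trans (Eq.trans ?_ h2.symm)
    congr 2
    rw [hy]

theorem rel_trans {p q r : PreGerm D} (h1 : p.Rel q) (h2 : q.Rel r) : p.Rel r := by
  rw [rel_iff] at *
  obtain ⟨hx, hy, n, m, g, hp, hq⟩ := h1
  obtain ⟨hx', hy', n', m', g', hq', hr⟩ := h2
  refine ⟨hx.trans hx', hy.trans hy', ?_⟩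
  rcases le_total n n' with hn | hn
  · obtain ⟨k, rfl⟩ := Nat.exists_eq_add_of_le hn
    obtain ⟨rfl, rfl⟩ := hq'.unique (hq.shift k)
    exact ⟨_, _, _, hp.shift k, by rw [hx]; exact hr⟩
  · obtain ⟨k, rfl⟩ := Nat.exists_eq_add_of_le hn
    obtain ⟨rfl, rfl⟩ := hq.unique (hq'.shift k)
    exact ⟨_, _, _, hp, by rw [hx']; exact hr.shift k⟩

theorem rel_equivalence : Equivalence (PreGerm.Rel (D := D)) where
  refl p := (rel_iff p p).2 ⟨rfl, rfl, _, _, _, p.data_self, p.data_self⟩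
  symm {p q} h := by
    rw [rel_iff] at *
    obtain ⟨hx, hy, n, m, g, hp, hq⟩ := h
    exact ⟨hx.symm, hy.symm, n, m, g, hq, hp⟩
  trans := rel_trans

instance setoid : Setoid (PreGerm D) := ⟨PreGerm.Rel, rel_equivalence⟩

/-- The pair `(s^*, s · x)`. -/
def inv (p : PreGerm D) : PreGerm D := ⟨p.s.adj, p.tgt, p.mem_Z_tgt⟩

theorem inv_tgt (p : PreGerm D) : p.inv.tgt = p.x := by
  ext1
  change p.s.b.edges ++ₛ D.actS p.s.g⁻¹ ((p.tgt.drop p.s.a.length).seq) = _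
  rw [p.data_self.drop_tgt]
  change p.s.b.edges ++ₛ D.actS p.s.g⁻¹ (D.actS p.s.g (p.x.seq.drop _)) = _
  rw [← actS_mul, inv_mul_cancel, actS_one]
  rw [FinPath.edges_eq p.hx]
  exact Stream'.append_take_drop _ _

theorem Data.inv {p : PreGerm D} {n m : ℕ} {g : G} (h : p.Data n m g) : p.inv.Data m n g⁻¹ := by
  obtain ⟨k, rfl, rfl, rfl⟩ := h
  refine ⟨k, rfl, rfl, ?_⟩
  change _ = D.cocL p.s.g⁻¹ ((p.tgt.drop p.s.a.length).seq.take k)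
  rw [p.data_self.drop_tgt]
  change _ = D.cocL p.s.g⁻¹ ((D.actS p.s.g (p.x.seq.drop p.s.b.length)).take k)
  rw [take_actS, inv_eq_iff_mul_eq_one, mul_eq_one_iff_eq_inv, ← mul_eq_one_iff_eq_inv',
    ← cocL_mul]
  simp

theorem inv_rel {p q : PreGerm D} (h : p.Rel q) : p.inv.Rel q.inv := by
  rw [rel_iff] at *
  obtain ⟨hx, hy, n, m, g, hp, hq⟩ := h
  exact ⟨hy, by rw [inv_tgt, inv_tgt, hx], _, _, _, hp.inv, hq.inv⟩

end PreGerm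

variable (D) in
/-- The groupoid of germs `𝒢_tight(S_{G,E})` of the action of `S_{G,E}` on the tight spectrum of
its semilattice of idempotents, which is identified with `E^∞`. -/
def Germ := Quotient (PreGerm.setoid (D := D))

namespace Germ

/-- The germ `[s, x]`. -/
def mk (s : Triple D) (x : InfPath D) (hx : x ∈ s.b.Z) : Germ D := Quotient.mk _ ⟨s, x, hx⟩

/-- The source map `[s, x] ↦ x`. -/
def src : Germ D → InfPath D := Quotient.lift PreGerm.x fun _ _ h => h.1

/-- The range map `[s, x] ↦ s · x`. -/
def rng : Germ D → InfPath D :=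
  Quotient.lift (fun p => p.s.act p.x p.hx) fun p q h => ((PreGerm.rel_iff p q).1 h).2.1

/-- The inverse `[s, x]⁻¹ = [s^*, s · x]`. -/
instance : Inv (Germ D) := ⟨Quotient.map PreGerm.inv fun _ _ h => PreGerm.inv_rel h⟩

/-- `IsComp a b c` means that `a` and `b` are composable with `ab = c`, where
`[s, t · x][t, x] = [st, x]`. -/
def IsComp (a b c : Germ D) : Prop :=
  ∃ (s t u : Triple D) (x : InfPath D) (hx : x ∈ t.b.Z) (hy : t.act x hx ∈ s.b.Z)
    (hu : x ∈ u.b.Z), SGE.of s * SGE.of t = SGE.of u ∧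
      a = mk s (t.act x hx) hy ∧ b = mk t x hx ∧ c = mk u x hu

end Germ

namespace PreGerm

theorem rel_eventually {p q : PreGerm D} (h : p.Rel q) :
    ∃ N, ∀ n ≥ N, ∀ m g, p.Data n m g → q.Data n m g := by
  obtain ⟨hx, -, n, m, g, hp, hq⟩ := (rel_iff p q).1 h
  refine ⟨n, fun n' hn m' g' h' => ?_⟩
  obtain ⟨j, rfl⟩ := Nat.exists_eq_add_of_le hn
  obtain ⟨rfl, rfl⟩ := h'.unique (hp.shift j)
  rw [hx]
  exact hq.shift j

/-- Auxiliary: compatibility of the data of `p`, `q` and of the product `r` of `p` and `q`. -/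
def Comp (p q r : PreGerm D) (n m k : ℕ) : Prop :=
  ∃ g h, q.Data n m h ∧ p.Data m k g ∧ r.Data n k (g * h)

theorem Comp.shift {p q r : PreGerm D} (h1 : p.x = q.tgt) (h2 : r.x = q.x) {n m k : ℕ}
    (h : Comp p q r n m k) (j : ℕ) : Comp p q r (n + j) (m + j) (k + j) := by
  obtain ⟨g, h, hq, hp, hr⟩ := h
  refine ⟨_, _, hq.shift j, hp.shift j, ?_⟩
  have := hr.shift j
  rw [cocL_mul, h2, ← take_actS] at this
  rw [h1]
  have h3 := congrArg InfPath.seq hq.drop_tgt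
  change q.tgt.seq.drop m = D.actS h (q.x.seq.drop n) at h3
  rw [h3]
  exact this

theorem exists_mul {p q : PreGerm D} (h : p.x = q.tgt) :
    ∃ r : PreGerm D, SGE.of p.s * SGE.of q.s = SGE.of r.s ∧ r.x = q.x ∧ r.tgt = p.tgt ∧
      ∃ n m k, Comp p q r n m k := by
  have key : ∀ u : Triple D, SGE.of p.s * SGE.of q.s = SGE.of u →
      ∀ hu : q.x ∈ u.b.Z, ∀ n m k, Comp p q ⟨u, q.x, hu⟩ n m k →
      (PreGerm.mk u q.x hu).tgt.seq.take k = p.tgt.seq.take k →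
      ∃ r : PreGerm D, SGE.of p.s * SGE.of q.s = SGE.of r.s ∧ r.x = q.x ∧ r.tgt = p.tgt ∧
        ∃ n m k, Comp p q r n m k := by
    intro u h1 hu n m k hc ht
    refine ⟨(⟨u, q.x, hu⟩ : PreGerm D), h1, rfl, ?_, n, m, k, hc⟩
    obtain ⟨g, h', hq, hp, hr⟩ := hc
    have e1 := congrArg InfPath.seq hr.drop_tgt
    have e2 := congrArg InfPath.seq hp.drop_tgt
    have e3 := congrArg InfPath.seq hq.drop_tgt
    change _ = D.actS g (p.x.seq.drop m) at e2
    change q.tgt.seq.drop m = D.actS h' (q.x.seq.drop n) at e3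
    change _ = D.actS (g * h') (q.x.seq.drop n) at e1
    rw [h, e3, ← actS_mul, ← e1] at e2
    ext1
    rw [← Stream'.append_take_drop k p.tgt.seq, ← ht]
    refine Eq.trans ?_ (congrArg (_ ++ₛ ·) e2.symm)
    exact (Stream'.append_take_drop k _).symm
  have hpb := p.hx
  rw [h] at hpb
  rcases le_total p.s.b.length q.s.a.length with hl | hl
  · obtain ⟨k, hk⟩ := Nat.exists_eq_add_of_le hl
    obtain ⟨u, h1, h2, h3, h4, h5⟩ := Triple.mul_of_append (s := p.s) (t := q.s)
      (w := (p.x.seq.drop p.s.b.length).take k)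
      ((FinPath.r_eq q.mem_Z_tgt).trans (FinPath.r_eq hpb).symm)
      (by rw [FinPath.edges_eq q.mem_Z_tgt, FinPath.edges_eq hpb, h, hk]
          exact Stream'.take_add _ _ _)
    have hua : u.a.length = p.s.a.length + k := by
      simp [FinPath.length, h3]
    refine key u h1 (h5 ▸ q.hx) _ _ _ ⟨_, _, q.data_self, ⟨k, hk, rfl, rfl⟩, ?_⟩ ?_
    · refine ⟨0, by rw [h5]; rfl, hua.symm, h4.symm⟩
    · rw [take_tgt, ← hua, ← h3]
      exact (FinPath.edges_eq (mem_Z_tgt ⟨u, q.x, h5 ▸ q.hx⟩)).symm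
  · obtain ⟨k, hk⟩ := Nat.exists_eq_add_of_le hl
    have hv : q.tgt.seq.drop q.s.a.length = D.actS q.s.g (q.x.seq.drop q.s.b.length) :=
      congrArg InfPath.seq q.data_self.drop_tgt
    obtain ⟨u, h1, h2, h3, h4, h5⟩ := Triple.mul_of_append' (s := p.s) (t := q.s)
      (w := D.actL q.s.g ((q.x.seq.drop q.s.b.length).take k))
      ((FinPath.r_eq hpb).trans (FinPath.r_eq q.mem_Z_tgt).symm)
      (by rw [FinPath.edges_eq q.mem_Z_tgt, FinPath.edges_eq hpb, hk, ← take_actS, ← hv]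
          exact Stream'.take_add _ _ _)
    rw [← actL_mul, inv_mul_cancel, actL_one] at h5
    have h6 : (D.cocL q.s.g⁻¹ (D.actL q.s.g ((q.x.seq.drop q.s.b.length).take k)))⁻¹ =
        D.cocL q.s.g ((q.x.seq.drop q.s.b.length).take k) := by
      rw [inv_eq_iff_mul_eq_one, ← cocL_mul]
      simp
    rw [h6] at h3
    have hub : u.b.length = q.s.b.length + k := by
      simp [FinPath.length, h5]
    have hu : u.b = q.x.pre (q.s.b.length + k) := by
      refine FinPath.ext (h4.trans (FinPath.r_eq q.hx)) (h5.trans ?_)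
      conv_lhs => rw [FinPath.edges_eq q.hx]
      exact (Stream'.take_add _ _ _).symm
    refine key u h1 (hu ▸ q.x.mem_Z_pre _) (q.s.b.length + k) p.s.b.length p.s.a.length
      ⟨_, _, ⟨k, rfl, hk, rfl⟩, p.data_self, ?_⟩ ?_
    · exact ⟨0, hub.symm, by rw [h2]; rfl, h3.symm⟩
    · refine Eq.trans ?_ (FinPath.edges_eq p.mem_Z_tgt)
      rw [← h2]
      exact (FinPath.edges_eq (mem_Z_tgt ⟨u, q.x, hu ▸ q.x.mem_Z_pre _⟩)).symm

end PreGerm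

namespace Germ

open PreGerm

theorem isComp_iff (p q r : PreGerm D) :
    IsComp (Quotient.mk _ p) (Quotient.mk _ q) (Quotient.mk _ r) ↔
      p.x = q.tgt ∧ r.x = q.x ∧ r.tgt = p.tgt ∧ ∃ n m k, Comp p q r n m k := by
  constructor
  · rintro ⟨s, t, u, x, hx, hy, hu, hm, ha, hb, hc⟩
    have ha' := Quotient.exact ha.symm
    have hb' := Quotient.exact hb.symm
    have hc' := Quotient.exact hc.symm
    obtain ⟨r', h1, h2, h3, n, m, k, h4⟩ :=
      exists_mul (p := ⟨s, t.act x hx, hy⟩) (q := ⟨t, x, hx⟩) rfl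
    have h1' := hm.symm.trans h1
    obtain ⟨u', x', hx'⟩ := r'
    injection h1' with h1'
    change x' = x at h2
    subst h2
    change u = u' at h1'
    subst h1'
    have e1 := (rel_iff _ _).1 ha'
    have e2 := (rel_iff _ _).1 hb'
    have e3 := (rel_iff _ _).1 hc'
    refine ⟨e1.1.symm.trans e2.2.1, e3.1.symm.trans e2.1,
      e3.2.1.symm.trans (h3.trans e1.2.1), ?_⟩
    obtain ⟨N1, f1⟩ := rel_eventually ha'
    obtain ⟨N2, f2⟩ := rel_eventually hb'
    obtain ⟨N3, f3⟩ := rel_eventually hc'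
    obtain ⟨g, h, hq, hp, hr⟩ := Comp.shift (p := ⟨s, t.act x' hx, hy⟩)
      (q := ⟨t, x', hx⟩) (r := ⟨u, x', hx'⟩) rfl rfl h4 (N1 + N2 + N3)
    exact ⟨_, _, _, g, h, f2 _ (by omega) _ _ hq, f1 _ (by omega) _ _ hp,
      f3 _ (by omega) _ _ hr⟩
  · rintro ⟨h1, h2, h3, n, m, k, h4⟩
    obtain ⟨r', h1', h2', h3', n', m', k', h4'⟩ := exists_mul h1
    have hr : Quotient.mk (PreGerm.setoid (D := D)) r = Quotient.mk _ r' := by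
      refine Quotient.sound ((rel_iff _ _).2 ⟨h2.trans h2'.symm, h3.trans h3'.symm, ?_⟩)
      obtain ⟨g, h, hq, hp, hr⟩ := h4.shift h1 h2 n'
      obtain ⟨g', h', hq', hp', hr'⟩ := h4'.shift h1 h2' n
      rw [Nat.add_comm n' n] at hq' hr'
      obtain ⟨e1, rfl⟩ := hq.unique hq'
      rw [e1] at hp
      obtain ⟨e2, rfl⟩ := hp.unique hp'
      rw [← e2] at hr'
      exact ⟨_, _, _, hr, hr'⟩
    rw [hr]
    obtain ⟨s, x, hx⟩ := p
    obtain ⟨t, y, hy⟩ := q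
    obtain ⟨u, z, hz⟩ := r'
    change z = y at h2'
    change x = t.act y hy at h1
    subst h2' h1
    exact ⟨s, t, u, z, hy, hx, hz, h1', rfl, rfl, rfl⟩

theorem IsComp.src_eq {a b c : Germ D} (h : IsComp a b c) : a.src = b.rng ∧ c.src = b.src ∧
    c.rng = a.rng := by
  induction a using Quotient.inductionOn
  induction b using Quotient.inductionOn
  induction c using Quotient.inductionOn
  obtain ⟨h1, h2, h3, -⟩ := (isComp_iff _ _ _).1 h
  exact ⟨h1, h2, h3⟩

/-- The product `ab` is defined and unique if `s(a) = r(b)`. -/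
theorem existsUnique_comp {a b : Germ D} (h : a.src = b.rng) : ∃! c, IsComp a b c := by
  induction a using Quotient.inductionOn with | _ p
  induction b using Quotient.inductionOn with | _ q
  obtain ⟨r, h1, h2, h3, h4⟩ := exists_mul (p := p) (q := q) h
  refine ⟨Quotient.mk _ r, (isComp_iff _ _ _).2 ⟨h, h2, h3, h4⟩, fun c hc => ?_⟩
  induction c using Quotient.inductionOn with | _ r'
  obtain ⟨h1', h2', h3', n', m', k', h4'⟩ := (isComp_iff _ _ _).1 hc
  obtain ⟨n, m, k, h4⟩ := h4
  refine Quotient.sound ((rel_iff _ _).2 ⟨h2'.trans h2.symm, h3'.trans h3.symm, ?_⟩)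
  obtain ⟨g, h, hq, hp, hr⟩ := h4.shift h1' h2 n'
  obtain ⟨g', h', hq', hp', hr'⟩ := h4'.shift h1' h2' n
  rw [Nat.add_comm n' n] at hq' hr'
  obtain ⟨e1, rfl⟩ := hq.unique hq'
  rw [e1] at hp
  obtain ⟨e2, rfl⟩ := hp.unique hp'
  rw [← e2] at hr'
  exact ⟨_, _, _, hr', hr⟩

theorem IsComp.unique {a b c c' : Germ D} (h : IsComp a b c) (h' : IsComp a b c') : c = c' :=
  (existsUnique_comp h.src_eq.1).unique h h'

/-- The product is associative. -/
theorem IsComp.assoc {a b c ab abc bc : Germ D} (h1 : IsComp a b ab) (h2 : IsComp ab c abc)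
    (h3 : IsComp b c bc) : IsComp a bc abc := by
  induction a using Quotient.inductionOn with | _ p
  induction b using Quotient.inductionOn with | _ q
  induction c using Quotient.inductionOn with | _ r
  induction ab using Quotient.inductionOn with | _ pq
  induction bc using Quotient.inductionOn with | _ qr
  induction abc using Quotient.inductionOn with | _ pqr
  rw [isComp_iff] at *
  obtain ⟨x1, x2, x3, n1, m1, k1, c1⟩ := h1
  obtain ⟨y1, y2, y3, n2, m2, k2, c2⟩ := h2
  obtain ⟨z1, z2, z3, n3, m3, k3, c3⟩ := h3
  refine ⟨x1.trans z3.symm, y2.trans z2.symm, y3.trans x3, ?_⟩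
  have c2' := c2.shift y1 y2 (n3 + n1)
  have c3' := c3.shift z1 z2 (n2 + n1)
  obtain ⟨g2, h2, a1, a2, a3⟩ := c2'
  obtain ⟨g3, h3, b1, b2, b3⟩ := c3'
  have e : n3 + (n2 + n1) = n2 + (n3 + n1) := by omega
  rw [e] at b1 b3
  obtain ⟨e1, rfl⟩ := a1.unique b1
  have c1' := c1.shift x1 x2 (m2 + n3)
  obtain ⟨g1, h1, d1, d2, d3⟩ := c1'
  have e' : n1 + (m2 + n3) = m2 + (n3 + n1) := by omega
  rw [e'] at d1 d3
  rw [e1] at d1 d3 a2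
  obtain ⟨e2, rfl⟩ := d1.unique b2
  obtain ⟨e3, rfl⟩ := d3.unique a2
  rw [e2] at d2
  rw [← e3] at a3
  exact ⟨_, _, _, _, _, b3, d2, by rw [← mul_assoc]; exact a3⟩

@[simp] theorem src_inv (a : Germ D) : a⁻¹.src = a.rng := by
  induction a using Quotient.inductionOn with | _ p
  rfl

@[simp] theorem rng_inv (a : Germ D) : a⁻¹.rng = a.src := by
  induction a using Quotient.inductionOn with | _ p
  exact p.inv_tgt

instance : InvolutiveInv (Germ D) where
  inv_inv a := by
    induction a using Quotient.inductionOn with | _ p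
    refine Quotient.sound ((rel_iff _ _).2 ⟨p.inv_tgt, p.inv.inv_tgt, ?_⟩)
    exact ⟨_, _, _, p.data_self.inv.inv, by rw [inv_inv]; exact p.data_self⟩

theorem IsComp.inv {a b c : Germ D} (h : IsComp a b c) : IsComp b⁻¹ a⁻¹ c⁻¹ := by
  induction a using Quotient.inductionOn with | _ p
  induction b using Quotient.inductionOn with | _ q
  induction c using Quotient.inductionOn with | _ r
  rw [isComp_iff] at h
  refine (isComp_iff _ _ _).2 ?_
  obtain ⟨h1, h2, h3, n, m, k, g, h, hq, hp, hr⟩ := h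
  refine ⟨?_, h3, ?_, k, m, n, h⁻¹, g⁻¹, hp.inv, hq.inv, ?_⟩
  · rw [p.inv_tgt, h1]; rfl
  · rw [r.inv_tgt, q.inv_tgt, h2]
  · rw [← mul_inv_rev]; exact hr.inv

end Germ

/-- The topology of `E^∞`: the relative topology of the product topology, where the set of edges
is discrete. -/
instance : TopologicalSpace (InfPath D) :=
  TopologicalSpace.induced (fun x n => x.seq.get n) (@Pi.topologicalSpace ℕ (fun _ => Ed) fun _ => ⊥)

namespace InfPath

open PiNat in
theorem isOpen_iff (U : Set (InfPath D)) : IsOpen U ↔ ∀ x ∈ U, ∃ n, (x.pre n).Z ⊆ U := by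
  let _ : TopologicalSpace Ed := ⊥
  have : DiscreteTopology Ed := ⟨rfl⟩
  have hb := (isTopologicalBasis_cylinders (fun _ : ℕ => Ed)).induced
    (fun (x : InfPath D) n => x.seq.get n)
  refine (hb.isOpen_iff (s := U)).trans (forall₂_congr fun x hx => ?_)
  have key : ∀ n (y : InfPath D), y.seq.take n = x.seq.take n ↔
      ∀ i < n, y.seq.get i = x.seq.get i := by
    intro n y
    constructor
    · intro h i hi
      have h1 := congrArg (fun l => l[i]?) h
      simpa [Stream'.getElem?_take hi] using h1
    · intro h
      refine List.ext_getElem (by simp) fun i hi hi' => ?_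
      rw [Stream'.take_get, Stream'.take_get]
      exact h i (by simpa using hi)
  constructor
  · rintro ⟨t, ⟨t', ⟨z, n, rfl⟩, rfl⟩, hxt, htU⟩
    refine ⟨n, fun y hy => htU ?_⟩
    have h1 := (key n y).1 (by simpa [pre] using ((FinPath.mem_Z _ _).1 hy).2)
    intro i hi
    exact (h1 i hi).trans (hxt i hi)
  · rintro ⟨n, hn⟩
    refine ⟨_, ⟨cylinder (fun n => x.seq.get n) (n + 1), ⟨_, n + 1, rfl⟩, rfl⟩,
      self_mem_cylinder _ _, fun y hy => hn ((FinPath.mem_Z _ _).2 ⟨?_, ?_⟩)⟩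
    · exact congrArg D.rng (hy 0 (by omega))
    · simpa [pre] using (key n y).2 fun i hi => hy i (by omega)

theorem mem_Z_pre_iff {x y : InfPath D} {n : ℕ} :
    y ∈ (x.pre n).Z ↔ y.r = x.r ∧ y.seq.take n = x.seq.take n := by
  rw [FinPath.mem_Z]
  simp [pre]

theorem Z_pre_anti (x : InfPath D) {m n : ℕ} (h : m ≤ n) : (x.pre n).Z ⊆ (x.pre m).Z := by
  intro y hy
  rw [mem_Z_pre_iff] at *
  refine ⟨hy.1, ?_⟩
  have := congrArg (List.take m) hy.2
  simpa [h] using this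

theorem isOpen_Z (β : FinPath D) : IsOpen β.Z := by
  rw [isOpen_iff]
  intro x hx
  exact ⟨β.length, by rw [← FinPath.eq_pre hx]⟩

theorem isClosed_Z (β : FinPath D) : IsClosed β.Z := by
  rw [← isOpen_compl_iff, isOpen_iff]
  intro x hx
  refine ⟨β.length, fun y hy hy' => hx ?_⟩
  have h1 := FinPath.eq_pre hy
  have h2 := FinPath.eq_pre hy'
  have h3 : (x.pre β.length).length = β.length := by simp [pre, FinPath.length]
  rw [h3, ← h2] at h1
  rw [← h1]
  exact x.mem_Z_pre _

variable (D) in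
/-- Auxiliary: the edges that can occur in position `n` of a path with range `v`. -/
def level (v : V) : ℕ → Set Ed
  | 0 => {e | D.rng e = v}
  | n + 1 => ⋃ e ∈ level v n, {f | D.rng f = D.src e}

theorem level_finite (v : V) (n : ℕ) : (level D v n).Finite := by
  induction n with
  | zero => exact D.row_finite v
  | succ n ih => exact ih.biUnion fun e _ => D.row_finite _

theorem isCompact_Z (β : FinPath D) : IsCompact β.Z := by
  let _ : TopologicalSpace Ed := ⊥
  have : DiscreteTopology Ed := ⟨rfl⟩
  have hK : IsCompact {x : InfPath D | x.r = β.r} := by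
    have hi : Topology.IsInducing (fun (x : InfPath D) (n : ℕ) => x.seq.get n) := ⟨rfl⟩
    rw [hi.isCompact_iff]
    have himg : (fun (x : InfPath D) (n : ℕ) => x.seq.get n) '' {x : InfPath D | x.r = β.r} =
        (Set.univ.pi (level D β.r)) ∩ ⋂ n, {σ : ℕ → Ed | D.src (σ n) = D.rng (σ (n + 1))} := by
      ext σ
      simp only [Set.mem_inter_iff, Set.mem_iInter, Set.mem_image]
      constructor
      · rintro ⟨x, hx, rfl⟩
        refine ⟨fun n _ => ?_, x.chain⟩
        induction n with
        | zero => exact hx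
        | succ n ih =>
          exact Set.mem_biUnion (ih trivial) (x.chain n).symm
      · rintro ⟨h1, h2⟩
        exact ⟨⟨σ, h2⟩, h1 0 trivial, rfl⟩
    rw [himg]
    refine (isCompact_univ_pi fun n => (level_finite _ n).isCompact).inter_right
      (isClosed_iInter fun n => ?_)
    have hc : Continuous fun σ : ℕ → Ed => (σ n, σ (n + 1)) := by fun_prop
    exact (isClosed_discrete {p : Ed × Ed | D.src p.1 = D.rng p.2}).preimage hc
  exact hK.of_isClosed_subset (isClosed_Z β) fun x hx => ((FinPath.mem_Z _ _).1 hx).1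

end InfPath

namespace Germ

open PreGerm

/-- The set `Θ(s, U) = {[s, x] : x ∈ U}`, where `U ⊆ Z(β)` for `s = (α, g, β)`. -/
def thetaOn (s : Triple D) (U : Set (InfPath D)) : Set (Germ D) :=
  {c | ∃ (x : InfPath D) (hx : x ∈ s.b.Z), x ∈ U ∧ c = mk s x hx}

/-- The set `Θ_s = {[s, x] : x ∈ Z(β)}` for `s = (α, g, β)`. -/
def theta (s : Triple D) : Set (Germ D) := thetaOn s s.b.Z

/-- The topology of the groupoid of germs, generated by the sets `Θ(s, U)` for `U ⊆ Z(β)` open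
in `E^∞`. -/
instance : TopologicalSpace (Germ D) :=
  TopologicalSpace.generateFrom
    {T | ∃ (s : Triple D) (U : Set (InfPath D)), IsOpen U ∧ U ⊆ s.b.Z ∧ T = thetaOn s U}

theorem isOpen_theta (s : Triple D) : IsOpen (theta s) :=
  .basic _ ⟨s, _, InfPath.isOpen_Z _, subset_rfl, rfl⟩

theorem mem_theta_iff {s : Triple D} {c : Germ D} :
    c ∈ theta s ↔ ∃ hx : c.src ∈ s.b.Z, c = mk s c.src hx := by
  constructor
  · rintro ⟨x, hx, -, rfl⟩
    exact ⟨hx, rfl⟩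
  · rintro ⟨hx, h⟩
    exact ⟨_, hx, hx, h⟩

/-- Auxiliary: the triple `se`, where `(s, x) = p` and `e` is given by an initial segment
of `x`. -/
def _root_.ExelPardo.PreGerm.trip (p : PreGerm D) {n m : ℕ} {g : G} (h : p.Data n m g) :
    Triple D := ⟨p.tgt.pre m, g, p.x.pre n, h.s_eq⟩

theorem mk_trip {p : PreGerm D} {n m : ℕ} {g : G} (h : p.Data n m g) {x : InfPath D}
    (hx : x ∈ (p.x.pre n).Z) : ∃ hx' : x ∈ p.s.b.Z, mk p.s x hx' = mk (p.trip h) x hx := by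
  obtain ⟨k, h1, h2, h3⟩ := id h
  have hx1 := FinPath.edges_eq hx
  have hlen : (p.x.pre n).length = n := by simp [InfPath.pre, FinPath.length]
  rw [hlen] at hx1
  change p.x.seq.take n = x.seq.take n at hx1
  rw [h1, Stream'.take_add, Stream'.take_add] at hx1
  obtain ⟨e1, e2⟩ := List.append_inj hx1 (by simp)
  have hx' : x ∈ p.s.b.Z := (FinPath.mem_Z _ _).2
    ⟨(FinPath.r_eq hx).symm.trans (FinPath.r_eq p.hx).symm,
      e1.symm.trans (FinPath.edges_eq p.hx).symm⟩
  have d1 : (⟨p.s, x, hx'⟩ : PreGerm D).Data n m g := ⟨k, h1, h2, by rw [h3, e2]⟩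
  have hlen' : (p.tgt.pre m).length = m := by simp [InfPath.pre, FinPath.length]
  have d2 : (⟨p.trip h, x, hx⟩ : PreGerm D).Data n m g := ⟨0, hlen.symm, hlen'.symm, rfl⟩
  refine ⟨hx', Quotient.sound ((rel_iff _ _).2 ⟨rfl, ?_, n, m, g, d1, d2⟩)⟩
  have e4 := take_tgt (p := (⟨p.s, x, hx'⟩ : PreGerm D)) k
  change _ = p.s.a.edges ++ D.actL p.s.g ((x.seq.drop p.s.b.length).take k) at e4
  rw [← e2, ← take_tgt, ← h2] at e4
  have e5 := FinPath.edges_eq (mem_Z_tgt (⟨p.trip h, x, hx⟩ : PreGerm D))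
  change p.tgt.seq.take m = Stream'.take (p.tgt.pre m).length _ at e5
  rw [hlen'] at e5
  exact InfPath.ext_take_drop m (e4.trans e5) (d1.drop_tgt.trans d2.drop_tgt.symm)

theorem isTopologicalBasis_theta :
    TopologicalSpace.IsTopologicalBasis (Set.range (theta (D := D))) := by
  refine TopologicalSpace.isTopologicalBasis_of_isOpen_of_nhds ?_ ?_
  · rintro _ ⟨s, rfl⟩
    exact isOpen_theta s
  · intro c U hc hU
    suffices h : ∀ p : PreGerm D, Quotient.mk _ p ∈ U → ∃ N, ∀ n ≥ N, ∀ m g,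
        ∀ h : p.Data n m g, theta (p.trip h) ⊆ U by
      induction c using Quotient.inductionOn with | _ p
      obtain ⟨N, hN⟩ := h p hc
      have hd := p.data_self.shift N
      refine ⟨_, ⟨p.trip hd, rfl⟩, ?_, hN _ (by omega) _ _ hd⟩
      obtain ⟨h1, h2⟩ := mk_trip hd (p.x.mem_Z_pre _)
      exact ⟨p.x, p.x.mem_Z_pre _, p.x.mem_Z_pre _, h2⟩
    clear hc c
    induction hU with
    | basic T hT =>
      obtain ⟨s, W, hW, hWs, rfl⟩ := hT
      rintro p ⟨x, hx, hxW, hp⟩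
      have hp' := Quotient.exact hp
      obtain rfl : p.x = x := hp'.1
      obtain ⟨N, hN⟩ := rel_eventually hp'
      obtain ⟨K, hK⟩ := (InfPath.isOpen_iff W).1 hW _ hxW
      refine ⟨N + K, fun n hn m g h => ?_⟩
      have h' := hN n (by omega) _ _ h
      have ht : (PreGerm.mk s p.x hx).trip h' = p.trip h := by
        unfold PreGerm.trip
        congr 2
        exact ((rel_iff _ _).1 hp').2.1.symm
      rw [← ht]
      rintro c ⟨x', hx', -, rfl⟩
      obtain ⟨h1, h2⟩ := mk_trip h' hx'
      exact ⟨x', h1, hK (InfPath.Z_pre_anti _ (by omega) hx'), h2.symm⟩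
    | univ => exact fun p _ => ⟨0, fun _ _ _ _ _ => Set.subset_univ _⟩
    | inter A B _ _ hA hB =>
      rintro p ⟨h1, h2⟩
      obtain ⟨N1, f1⟩ := hA p h1
      obtain ⟨N2, f2⟩ := hB p h2
      exact ⟨N1 + N2, fun n hn m g h =>
        Set.subset_inter (f1 n (by omega) m g h) (f2 n (by omega) m g h)⟩
    | sUnion S _ hS =>
      rintro p ⟨A, hA, hp⟩
      obtain ⟨N, f⟩ := hS A hA p hp
      exact ⟨N, fun n hn m g h => (f n hn m g h).trans (Set.subset_sUnion_of_mem hA)⟩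

theorem isCompact_theta (s : Triple D) : IsCompact (theta s) := by
  have h1 : theta s = Set.range fun x : s.b.Z => mk s x.1 x.2 := by
    ext c
    constructor
    · rintro ⟨x, hx, -, rfl⟩
      exact ⟨⟨x, hx⟩, rfl⟩
    · rintro ⟨⟨x, hx⟩, rfl⟩
      exact ⟨x, hx, hx, rfl⟩
  have : CompactSpace s.b.Z := isCompact_iff_compactSpace.1 (InfPath.isCompact_Z _)
  rw [h1]
  refine isCompact_range (isTopologicalBasis_theta.continuous_iff.2 ?_)
  rintro _ ⟨t, rfl⟩
  refine isOpen_iff_forall_mem_open.2 ?_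
  rintro ⟨x, hx⟩ ⟨x', hx', -, h⟩
  have hr := Quotient.exact h
  obtain rfl : x = x' := hr.1
  obtain ⟨N, hN⟩ := rel_eventually hr
  have hd := (PreGerm.data_self ⟨s, x, hx⟩).shift N
  have hd' := hN _ (by omega) _ _ hd
  have ht : (PreGerm.mk s x hx).trip hd = (PreGerm.mk t x hx').trip hd' := by
    unfold PreGerm.trip
    congr 2
    exact ((rel_iff _ _).1 hr).2.1
  refine ⟨Subtype.val ⁻¹' (x.pre _).Z, ?_, (InfPath.isOpen_Z _).preimage continuous_subtype_val,
    x.mem_Z_pre (s.b.length + N)⟩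
  rintro ⟨y, hy⟩ hyx
  obtain ⟨h1, h2⟩ := mk_trip hd hyx
  obtain ⟨h3, h4⟩ := mk_trip hd' hyx
  refine ⟨y, h3, h3, h2.trans (Eq.trans ?_ h4.symm)⟩
  congr 1

end Germ

theorem Triple.mul_eq_of {s t u : Triple D} (h : SGE.of s * SGE.of t = SGE.of u) :
    (∃ w, t.a.r = s.b.r ∧ t.a.edges = s.b.edges ++ w) ∨
      ∃ w, s.b.r = t.a.r ∧ s.b.edges = t.a.edges ++ w := by
  by_contra hn
  push Not at hn
  have H1 : ¬ ∃ (ε : FinPath D) (hε : s.b.s = ε.r), t.a = s.b.append ε hε := by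
    rintro ⟨ε, hε, h⟩
    exact hn.1 ε.edges (by rw [h]; rfl) (by rw [h]; rfl)
  have H2 : ¬ ∃ (ε : FinPath D) (hε : t.a.s = ε.r), s.b = t.a.append ε hε := by
    rintro ⟨ε, hε, h⟩
    exact hn.2 ε.edges (by rw [h]; rfl) (by rw [h]; rfl)
  have h0 : SGE.of s * SGE.of t = SGE.zero := (dif_neg H1).trans (dif_neg H2)
  rw [h0] at h
  injection h

theorem FinPath.mem_Z_of_take {β : FinPath D} {x : InfPath D} {w : List Ed} (hr : x.r = β.r)
    (h : x.seq.take (β.edges ++ w).length = β.edges ++ w) : x ∈ β.Z := by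
  refine (FinPath.mem_Z _ _).2 ⟨hr, ?_⟩
  have := congrArg (List.take β.edges.length) h
  simpa using this

namespace Germ

open PreGerm

/-- The product set `UV = {ab : a ∈ U, b ∈ V, s(a) = r(b)}`. -/
def mulSet (U V : Set (Germ D)) : Set (Germ D) := {c | ∃ a ∈ U, ∃ b ∈ V, IsComp a b c}

/-- A bisection: the source map and the range map are injective on `U`. -/
def IsBisection (U : Set (Germ D)) : Prop := Set.InjOn src U ∧ Set.InjOn rng U

/-- A compact open bisection. -/
structure IsCompactOpenBisection (U : Set (Germ D)) : Prop where
  isCompact : IsCompact U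
  isOpen : IsOpen U
  isBisection : IsBisection U

theorem mulSet_theta_of {s t u : Triple D} (h : SGE.of s * SGE.of t = SGE.of u) :
    mulSet (theta s) (theta t) = theta u := by
  ext c
  constructor
  · rintro ⟨_, ⟨y, hy, -, rfl⟩, _, ⟨x, hx, -, rfl⟩, hc⟩
    obtain ⟨r, h1, h2, h3, h4⟩ := exists_mul (p := ⟨s, y, hy⟩) (q := ⟨t, x, hx⟩) hc.src_eq.1
    obtain rfl := hc.unique ((isComp_iff ⟨s, y, hy⟩ ⟨t, x, hx⟩ r).2 ⟨hc.src_eq.1, h2, h3, h4⟩)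
    have h5 := h.symm.trans h1
    injection h5 with h5
    subst h5
    exact ⟨r.x, r.hx, r.hx, rfl⟩
  · rintro ⟨x, hu, -, rfl⟩
    have key : ∃ hx : x ∈ t.b.Z, t.act x hx ∈ s.b.Z := by
      rcases Triple.mul_eq_of h with ⟨w, hr, he⟩ | ⟨w, hr, he⟩
      · obtain ⟨u', h1, -, -, -, h5⟩ := Triple.mul_of_append hr he
        have h6 := h.symm.trans h1
        injection h6 with h6
        subst h6
        have hx : x ∈ t.b.Z := h5 ▸ hu
        have h7 := mem_Z_tgt ⟨t, x, hx⟩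
        refine ⟨hx, FinPath.mem_Z_of_take (w := w) ((FinPath.r_eq h7).symm.trans hr) ?_⟩
        rw [← he]
        exact (FinPath.edges_eq h7).symm
      · obtain ⟨u', h1, -, -, h4, h5⟩ := Triple.mul_of_append' hr he
        have h6 := h.symm.trans h1
        injection h6 with h6
        subst h6
        have h8 := FinPath.edges_eq hu
        unfold FinPath.length at h8
        rw [h5] at h8
        have hx : x ∈ t.b.Z :=
          FinPath.mem_Z_of_take ((FinPath.r_eq hu).symm.trans h4) h8.symm
        have h7 := mem_Z_tgt ⟨t, x, hx⟩
        refine ⟨hx, (FinPath.mem_Z _ _).2 ⟨(FinPath.r_eq h7).symm.trans hr.symm, ?_⟩⟩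
        have h9 := take_tgt (p := ⟨t, x, hx⟩) w.length
        rw [he, List.length_append]
        refine h9.trans (congrArg (_ ++ ·) ?_)
        change D.actL t.g ((x.seq.drop t.b.edges.length).take w.length) = w
        rw [List.length_append, length_actL, Stream'.take_add] at h8
        have h10 := (List.append_inj' h8 (by simp)).2
        rw [← h10, ← actL_mul, mul_inv_cancel, actL_one]
    obtain ⟨hx, hy⟩ := key
    exact ⟨mk s _ hy, ⟨_, hy, hy, rfl⟩, mk t x hx, ⟨_, hx, hx, rfl⟩,
      ⟨s, t, u, x, hx, hy, hu, h, rfl, rfl, rfl⟩⟩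

theorem mulSet_theta_zero {s t : Triple D} (h : SGE.of s * SGE.of t = SGE.zero) :
    mulSet (theta s) (theta t) = ∅ := by
  refine Set.eq_empty_iff_forall_notMem.2 ?_
  rintro c ⟨_, ⟨y, hy, -, rfl⟩, _, ⟨x, hx, -, rfl⟩, hc⟩
  obtain ⟨r, h1, -⟩ := exists_mul (p := ⟨s, y, hy⟩) (q := ⟨t, x, hx⟩) hc.src_eq.1
  have h2 := h.symm.trans h1
  injection h2

theorem inv_mem_theta {s : Triple D} {c : Germ D} : c⁻¹ ∈ theta s ↔ c ∈ theta s.adj := by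
  have key : ∀ (s : Triple D) (c : Germ D), c ∈ theta s → c⁻¹ ∈ theta s.adj := by
    rintro s _ ⟨x, hx, -, rfl⟩
    exact ⟨_, mem_Z_tgt ⟨s, x, hx⟩, mem_Z_tgt ⟨s, x, hx⟩, rfl⟩
  have hs : s.adj.adj = s := Triple.ext rfl (inv_inv _) rfl
  exact ⟨fun h => inv_inv c ▸ key _ _ h, fun h => hs ▸ key _ _ h⟩

theorem isCompact_isOpen_iff (U : Set (Germ D)) :
    IsCompact U ∧ IsOpen U ↔ ∃ A : Set (Triple D), A.Finite ∧ U = ⋃ s ∈ A, theta s :=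
  isCompact_open_iff_eq_finite_iUnion_of_isTopologicalBasis _ isTopologicalBasis_theta
    isCompact_theta U

theorem isCompactOpenBisection_theta (s : Triple D) : IsCompactOpenBisection (theta s) := by
  have h : ∀ s : Triple D, Set.InjOn src (theta s) := by
    rintro s _ ⟨x, hx, -, rfl⟩ _ ⟨y, hy, -, rfl⟩ h
    obtain rfl : x = y := h
    rfl
  refine ⟨isCompact_theta s, isOpen_theta s, h s, fun a ha b hb hab => ?_⟩
  refine inv_injective (h s.adj ?_ ?_ (by simpa using hab))
  · rwa [← inv_mem_theta, inv_inv]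
  · rwa [← inv_mem_theta, inv_inv]

theorem IsCompactOpenBisection.mul {U V : Set (Germ D)} (hU : IsCompactOpenBisection U)
    (hV : IsCompactOpenBisection V) : IsCompactOpenBisection (mulSet U V) := by
  have h : IsCompact (mulSet U V) ∧ IsOpen (mulSet U V) := by
    obtain ⟨A, hA, rfl⟩ := (isCompact_isOpen_iff U).1 ⟨hU.1, hU.2⟩
    obtain ⟨B, hB, rfl⟩ := (isCompact_isOpen_iff V).1 ⟨hV.1, hV.2⟩
    have he : mulSet (⋃ s ∈ A, theta s) (⋃ s ∈ B, theta s) =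
        ⋃ s ∈ A, ⋃ t ∈ B, mulSet (theta s) (theta t) := by
      ext c
      simp only [mulSet, Set.mem_iUnion, Set.mem_ofPred_eq]
      constructor
      · rintro ⟨a, ⟨s, hs, ha⟩, b, ⟨t, ht, hb⟩, hc⟩
        exact ⟨s, hs, t, ht, a, ha, b, hb, hc⟩
      · rintro ⟨s, hs, t, ht, a, ha, b, hb, hc⟩
        exact ⟨a, ⟨s, hs, ha⟩, b, ⟨t, ht, hb⟩, hc⟩
    have key : ∀ s t : Triple D, IsCompact (mulSet (theta s) (theta t)) ∧
        IsOpen (mulSet (theta s) (theta t)) := by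
      intro s t
      rcases h : SGE.of s * SGE.of t with _ | u
      · rw [mulSet_theta_zero h]
        exact ⟨isCompact_empty, isOpen_empty⟩
      · rw [mulSet_theta_of h]
        exact ⟨isCompact_theta u, isOpen_theta u⟩
    rw [he]
    exact ⟨hA.isCompact_biUnion fun s _ => hB.isCompact_biUnion fun t _ => (key s t).1,
      isOpen_biUnion fun s _ => isOpen_biUnion fun t _ => (key s t).2⟩
  refine ⟨h.1, h.2, ?_, ?_⟩
  · rintro c ⟨a, ha, b, hb, hc⟩ c' ⟨a', ha', b', hb', hc'⟩ h
    obtain rfl := hV.3.1 hb hb' (hc.src_eq.2.1.symm.trans (h.trans hc'.src_eq.2.1))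
    obtain rfl := hU.3.1 ha ha' (hc.src_eq.1.trans hc'.src_eq.1.symm)
    exact hc.unique hc'
  · rintro c ⟨a, ha, b, hb, hc⟩ c' ⟨a', ha', b', hb', hc'⟩ h
    obtain rfl := hU.3.2 ha ha' (hc.src_eq.2.2.symm.trans (h.trans hc'.src_eq.2.2))
    obtain rfl := hV.3.2 hb hb' (hc.src_eq.1.symm.trans hc'.src_eq.1)
    exact hc.unique hc'

theorem IsCompactOpenBisection.inv {U : Set (Germ D)} (hU : IsCompactOpenBisection U) :
    IsCompactOpenBisection {c | c⁻¹ ∈ U} := by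
  have h : IsCompact {c | c⁻¹ ∈ U} ∧ IsOpen {c | c⁻¹ ∈ U} := by
    obtain ⟨A, hA, rfl⟩ := (isCompact_isOpen_iff U).1 ⟨hU.1, hU.2⟩
    have he : {c : Germ D | c⁻¹ ∈ ⋃ s ∈ A, theta s} = ⋃ s ∈ A, theta s.adj := by
      ext c
      simp [inv_mem_theta]
    rw [he]
    exact ⟨hA.isCompact_biUnion fun s _ => isCompact_theta _,
      isOpen_biUnion fun s _ => isOpen_theta _⟩
  refine ⟨h.1, h.2, fun a ha b hb hab => ?_, fun a ha b hb hab => ?_⟩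
  · exact inv_injective (hU.3.2 ha hb (by simpa using hab))
  · exact inv_injective (hU.3.1 ha hb (by simpa using hab))

theorem mulSet_assoc (U V W : Set (Germ D)) :
    mulSet (mulSet U V) W = mulSet U (mulSet V W) := by
  ext c
  constructor
  · rintro ⟨_, ⟨a, ha, b, hb, h1⟩, d, hd, h2⟩
    obtain ⟨e, he, -⟩ := existsUnique_comp (h1.src_eq.2.1.symm.trans h2.src_eq.1)
    exact ⟨a, ha, e, ⟨b, hb, d, hd, he⟩, h1.assoc h2 he⟩
  · rintro ⟨a, ha, _, ⟨b, hb, d, hd, h1⟩, h2⟩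
    obtain ⟨e, he, -⟩ := existsUnique_comp (h2.src_eq.1.trans h1.src_eq.2.2)
    refine ⟨e, ⟨a, ha, b, hb, he⟩, d, hd, ?_⟩
    have := h1.inv.assoc h2.inv he.inv
    simpa using this.inv

theorem inv_mulSet (U V : Set (Germ D)) :
    {c | c⁻¹ ∈ mulSet U V} = mulSet {c | c⁻¹ ∈ V} {c | c⁻¹ ∈ U} := by
  ext c
  constructor
  · rintro ⟨a, ha, b, hb, h⟩
    exact ⟨b⁻¹, by simpa using hb, a⁻¹, by simpa using ha, by simpa using h.inv⟩
  · rintro ⟨a, ha, b, hb, h⟩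
    exact ⟨b⁻¹, hb, a⁻¹, ha, h.inv⟩

end Germ

namespace Germ

variable {R : Type*} [CommRing R]

/-- The convolution `(f * g)(c) = ∑_{ab = c} f(a) g(b)`. -/
noncomputable def conv (f g : Germ D → R) (c : Germ D) : R :=
  ∑ᶠ p ∈ {p : Germ D × Germ D | IsComp p.1 p.2 c}, f p.1 * g p.2

variable (D R) in
/-- The `R`-linear span of the characteristic functions of the compact open bisections. -/
def steinbergModule : Submodule R (Germ D → R) :=
  Submodule.span R {f | ∃ U : Set (Germ D), IsCompactOpenBisection U ∧ f = U.indicator 1}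

theorem indicator_mem {U : Set (Germ D)} (hU : IsCompactOpenBisection U) :
    (U.indicator 1 : Germ D → R) ∈ steinbergModule D R := Submodule.subset_span ⟨U, hU, rfl⟩

theorem finite_fibre {f : Germ D → R} (hf : f ∈ steinbergModule D R) (x : InfPath D) :
    {a | a.rng = x ∧ f a ≠ 0}.Finite ∧ {a | a.src = x ∧ f a ≠ 0}.Finite := by
  induction hf using Submodule.span_induction with
  | mem f h =>
    obtain ⟨U, hU, rfl⟩ := h
    constructor
    · refine Set.Subsingleton.finite fun a ha b hb => hU.3.2 ?_ ?_ (ha.1.trans hb.1.symm)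
      exacts [Set.mem_of_indicator_ne_zero ha.2, Set.mem_of_indicator_ne_zero hb.2]
    · refine Set.Subsingleton.finite fun a ha b hb => hU.3.1 ?_ ?_ (ha.1.trans hb.1.symm)
      exacts [Set.mem_of_indicator_ne_zero ha.2, Set.mem_of_indicator_ne_zero hb.2]
  | zero => simp
  | add f g _ _ hf hg =>
    have h : ∀ a, (f + g) a ≠ 0 → f a ≠ 0 ∨ g a ≠ 0 := by
      intro a ha
      by_contra hn
      push Not at hn
      exact ha (by simp [hn.1, hn.2])
    refine ⟨(hf.1.union hg.1).subset ?_, (hf.2.union hg.2).subset ?_⟩ <;>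
    · rintro a ⟨h1, h2⟩
      exact (h a h2).imp (⟨h1, ·⟩) (⟨h1, ·⟩)
  | smul r f _ hf =>
    refine ⟨hf.1.subset ?_, hf.2.subset ?_⟩ <;>
    · rintro a ⟨h1, h2⟩
      exact ⟨h1, fun h => h2 (by simp [h])⟩

theorem finite_conv {f g : Germ D → R} (hf : f ∈ steinbergModule D R)
    (hg : g ∈ steinbergModule D R) (c : Germ D) :
    ({p : Germ D × Germ D | IsComp p.1 p.2 c} ∩
      Function.support fun p : Germ D × Germ D => f p.1 * g p.2).Finite := by
  refine ((finite_fibre hf c.rng).1.prod (finite_fibre hg c.src).2).subset ?_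
  rintro ⟨a, b⟩ ⟨h1, h2⟩
  exact ⟨⟨h1.src_eq.2.2.symm, left_ne_zero_of_mul h2⟩,
    ⟨h1.src_eq.2.1.symm, right_ne_zero_of_mul h2⟩⟩

theorem conv_add {f g h : Germ D → R} (hf : f ∈ steinbergModule D R)
    (hg : g ∈ steinbergModule D R) (hh : h ∈ steinbergModule D R) :
    conv f (g + h) = conv f g + conv f h := by
  ext c
  refine Eq.trans ?_ (finsum_mem_add_distrib' (finite_conv hf hg c) (finite_conv hf hh c))
  exact finsum_mem_congr rfl fun p _ => mul_add _ _ _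

theorem add_conv {f g h : Germ D → R} (hf : f ∈ steinbergModule D R)
    (hg : g ∈ steinbergModule D R) (hh : h ∈ steinbergModule D R) :
    conv (f + g) h = conv f h + conv g h := by
  ext c
  refine Eq.trans ?_ (finsum_mem_add_distrib' (finite_conv hf hh c) (finite_conv hg hh c))
  exact finsum_mem_congr rfl fun p _ => add_mul _ _ _

theorem smul_conv {f g : Germ D → R} (hf : f ∈ steinbergModule D R)
    (hg : g ∈ steinbergModule D R) (r : R) : conv (r • f) g = r • conv f g := by
  ext c
  refine Eq.trans ?_ ((AddMonoidHom.mulLeft r).map_finsum_mem' (finite_conv hf hg c)).symm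
  exact finsum_mem_congr rfl fun p _ => mul_assoc _ _ _

theorem conv_smul {f g : Germ D → R} (hf : f ∈ steinbergModule D R)
    (hg : g ∈ steinbergModule D R) (r : R) : conv f (r • g) = r • conv f g := by
  ext c
  refine Eq.trans ?_ ((AddMonoidHom.mulLeft r).map_finsum_mem' (finite_conv hf hg c)).symm
  exact finsum_mem_congr rfl fun p _ => mul_left_comm _ _ _

@[simp] theorem zero_conv (f : Germ D → R) : conv 0 f = 0 := by
  ext c
  simp [conv]

@[simp] theorem conv_zero (f : Germ D → R) : conv f 0 = 0 := by
  ext c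
  simp [conv]

theorem conv_indicator {U V : Set (Germ D)} (hU : IsCompactOpenBisection U)
    (hV : IsCompactOpenBisection V) :
    conv (U.indicator 1 : Germ D → R) (V.indicator 1) = (mulSet U V).indicator 1 := by
  classical
  ext c
  unfold conv
  by_cases hc : c ∈ mulSet U V
  · rw [Set.indicator_of_mem hc]
    obtain ⟨a, ha, b, hb, h⟩ := hc
    rw [finsum_mem_def, finsum_eq_single _ (a, b)]
    · rw [Set.indicator_of_mem (show (a, b) ∈ {p : Germ D × Germ D | IsComp p.1 p.2 c} from h)]
      simp [ha, hb]
    · rintro ⟨a', b'⟩ hne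
      by_contra hn
      have h1 : (a', b') ∈ {p : Germ D × Germ D | IsComp p.1 p.2 c} :=
        Set.mem_of_indicator_ne_zero hn
      rw [Set.indicator_of_mem h1] at hn
      replace h1 : IsComp a' b' c := h1
      have ha' := Set.mem_of_indicator_ne_zero (left_ne_zero_of_mul hn)
      have hb' := Set.mem_of_indicator_ne_zero (right_ne_zero_of_mul hn)
      refine hne (Prod.ext (hU.3.2 ha' ha ?_) (hV.3.1 hb' hb ?_))
      · exact h1.src_eq.2.2.symm.trans h.src_eq.2.2
      · exact h1.src_eq.2.1.symm.trans h.src_eq.2.1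
  · rw [Set.indicator_of_notMem hc]
    refine (finsum_mem_congr rfl fun p hp => ?_).trans (finsum_mem_zero _)
    by_contra hn
    exact hc ⟨p.1, Set.mem_of_indicator_ne_zero (left_ne_zero_of_mul hn), p.2,
      Set.mem_of_indicator_ne_zero (right_ne_zero_of_mul hn), hp⟩

theorem conv_mem {f g : Germ D → R} (hf : f ∈ steinbergModule D R)
    (hg : g ∈ steinbergModule D R) : conv f g ∈ steinbergModule D R := by
  induction hf using Submodule.span_induction with
  | mem f h =>
    obtain ⟨U, hU, rfl⟩ := h
    induction hg using Submodule.span_induction with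
    | mem g h =>
      obtain ⟨V, hV, rfl⟩ := h
      rw [conv_indicator hU hV]
      exact indicator_mem (hU.mul hV)
    | zero => simp
    | add g h hg hh ih ih' =>
      rw [conv_add (indicator_mem hU) hg hh]
      exact add_mem ih ih'
    | smul r g hg ih =>
      rw [conv_smul (indicator_mem hU) hg]
      exact Submodule.smul_mem _ _ ih
  | zero => simp
  | add f f' hf hf' ih ih' =>
    rw [add_conv hf hf' hg]
    exact add_mem ih ih'
  | smul r f hf ih =>
    rw [smul_conv hf hg]
    exact Submodule.smul_mem _ _ ih

theorem conv_assoc {f g h : Germ D → R} (hf : f ∈ steinbergModule D R)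
    (hg : g ∈ steinbergModule D R) (hh : h ∈ steinbergModule D R) :
    conv (conv f g) h = conv f (conv g h) := by
  induction hf using Submodule.span_induction with
  | mem f h1 =>
    obtain ⟨U, hU, rfl⟩ := h1
    have mU := indicator_mem (R := R) hU
    induction hg using Submodule.span_induction with
    | mem g h2 =>
      obtain ⟨V, hV, rfl⟩ := h2
      have mV := indicator_mem (R := R) hV
      induction hh using Submodule.span_induction with
      | mem h h3 =>
        obtain ⟨W, hW, rfl⟩ := h3
        rw [conv_indicator hU hV, conv_indicator (hU.mul hV) hW, conv_indicator hV hW,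
          conv_indicator hU (hV.mul hW), mulSet_assoc]
      | zero => simp
      | add g h hg hh ih ih' =>
        rw [conv_add (conv_mem mU mV) hg hh, conv_add mV hg hh,
          conv_add mU (conv_mem mV hg) (conv_mem mV hh), ih, ih']
      | smul r g hg ih =>
        rw [conv_smul (conv_mem mU mV) hg, conv_smul mV hg, conv_smul mU (conv_mem mV hg), ih]
    | zero => simp
    | add g g' hg hg' ih ih' =>
      rw [conv_add mU hg hg', add_conv (conv_mem mU hg) (conv_mem mU hg') hh,
        add_conv hg hg' hh, conv_add mU (conv_mem hg hh) (conv_mem hg' hh), ih, ih']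
    | smul r g hg ih =>
      rw [conv_smul mU hg, smul_conv (conv_mem mU hg) hh, smul_conv hg hh,
        conv_smul mU (conv_mem hg hh), ih]
  | zero => simp
  | add f f' hf hf' ih ih' =>
    rw [add_conv hf hf' hg, add_conv (conv_mem hf hg) (conv_mem hf' hg) hh,
      add_conv hf hf' (conv_mem hg hh), ih, ih']
  | smul r f hf ih =>
    rw [smul_conv hf hg, smul_conv (conv_mem hf hg) hh, smul_conv hf (conv_mem hg hh), ih]

variable [StarRing R]

/-- The involution `f^*(c) = f(c⁻¹)^*`. -/
def adj (f : Germ D → R) (c : Germ D) : R := star (f c⁻¹)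

theorem adj_mem {f : Germ D → R} (hf : f ∈ steinbergModule D R) :
    adj f ∈ steinbergModule D R := by
  induction hf using Submodule.span_induction with
  | mem f h =>
    obtain ⟨U, hU, rfl⟩ := h
    have : adj (U.indicator 1 : Germ D → R) = {c | c⁻¹ ∈ U}.indicator 1 := by
      classical
      ext c
      by_cases hc : c⁻¹ ∈ U <;> simp [adj, hc]
    rw [this]
    exact indicator_mem hU.inv
  | zero =>
    have : adj (0 : Germ D → R) = 0 := by ext c; simp [adj]
    rw [this]
    exact zero_mem _
  | add f g _ _ ih ih' =>
    have : adj (f + g) = adj f + adj g := by ext c; simp [adj]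
    rw [this]
    exact add_mem ih ih'
  | smul r f _ ih =>
    have : adj (r • f) = star r • adj f := by ext c; simp [adj]
    rw [this]
    exact Submodule.smul_mem _ _ ih

theorem adj_conv {f g : Germ D → R} (hf : f ∈ steinbergModule D R)
    (hg : g ∈ steinbergModule D R) : adj (conv f g) = conv (adj g) (adj f) := by
  ext c
  refine ((starAddEquiv (R := R)).toAddMonoidHom.map_finsum_mem' (finite_conv hf hg c⁻¹)).trans ?_
  refine finsum_mem_eq_of_bijOn (fun p => (p.2⁻¹, p.1⁻¹)) ⟨?_, ?_, ?_⟩ ?_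
  · intro p hp
    have h : IsComp p.1 p.2 c⁻¹ := hp
    simpa using h.inv
  · intro p _ q _ h
    simp only [Prod.mk.injEq, inv_inj] at h
    exact Prod.ext h.2 h.1
  · intro p hp
    have h : IsComp p.1 p.2 c := hp
    exact ⟨(p.2⁻¹, p.1⁻¹), h.inv, by simp⟩
  · intro p _
    simp [adj, mul_comm]

end Germ

open ExelPardo.Germ

variable (D) in
/-- The Steinberg algebra `A_R(𝒢_tight(S_{G,E}))`: the span of the characteristic functions of
the compact open bisections, as a `*`-algebra under convolution. -/
def SteinbergAlgebra (R : Type*) [CommRing R] : Type _ := steinbergModule D R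

namespace SteinbergAlgebra

variable {R : Type*} [CommRing R]

/-- The characteristic function `1_U` of a compact open bisection `U`. -/
noncomputable def char (R : Type*) [CommRing R] (U : Set (Germ D))
    (hU : IsCompactOpenBisection U) : SteinbergAlgebra D R := ⟨U.indicator 1, indicator_mem hU⟩

noncomputable instance : AddCommGroup (SteinbergAlgebra D R) :=
  inferInstanceAs (AddCommGroup (steinbergModule D R))

noncomputable instance : Module R (SteinbergAlgebra D R) :=
  inferInstanceAs (Module R (steinbergModule D R))

noncomputable instance : Mul (SteinbergAlgebra D R) :=
  ⟨fun f g => ⟨conv f.1 g.1, conv_mem f.2 g.2⟩⟩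

noncomputable instance : NonUnitalRing (SteinbergAlgebra D R) where
  left_distrib f g h := Subtype.ext (conv_add f.2 g.2 h.2)
  right_distrib f g h := Subtype.ext (add_conv f.2 g.2 h.2)
  zero_mul f := Subtype.ext (zero_conv f.1)
  mul_zero f := Subtype.ext (conv_zero f.1)
  mul_assoc f g h := Subtype.ext (conv_assoc f.2 g.2 h.2)

noncomputable instance [StarRing R] : StarRing (SteinbergAlgebra D R) where
  star f := ⟨adj f.1, adj_mem f.2⟩
  star_involutive f := Subtype.ext (funext fun c =>
    (star_star (f.1 c⁻¹⁻¹)).trans (congrArg f.1 (inv_inv c)))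
  star_mul f g := Subtype.ext (adj_conv f.2 g.2)
  star_add f g := Subtype.ext (funext fun c => star_add (f.1 c⁻¹) (g.1 c⁻¹))

instance : IsScalarTower R (SteinbergAlgebra D R) (SteinbergAlgebra D R) :=
  ⟨fun r f g => Subtype.ext (smul_conv f.2 g.2 r)⟩

instance : SMulCommClass R (SteinbergAlgebra D R) (SteinbergAlgebra D R) :=
  ⟨fun r f g => Subtype.ext (conv_smul f.2 g.2 r).symm⟩

instance [StarRing R] : StarModule R (SteinbergAlgebra D R) :=
  ⟨fun r f => Subtype.ext (funext fun c => star_mul' r (f.1 c⁻¹))⟩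

end SteinbergAlgebra

namespace Triple

/-- The element `(v, f, f⁻¹ · v)` of `S_{G,E}`. -/
def ofVertex (D : SelfSimilarGraph G V Ed) (v : V) (f : G) : Triple D :=
  ⟨.vertex D v, f, .vertex D (f⁻¹ • v), (smul_inv_smul f v).symm⟩

/-- The element `(e, g, g⁻¹ · s(e))` of `S_{G,E}`. -/
def ofEdge (D : SelfSimilarGraph G V Ed) (e : Ed) (g : G) : Triple D :=
  ⟨.edge D e, g, .vertex D (g⁻¹ • D.src e), (smul_inv_smul g (D.src e)).symm⟩

end Triple

/-- A representation of the family of compact open bisections of the groupoid of germs in an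
algebra `B`. -/
structure IsRepresentation {B : Type*} [NonUnitalRing B]
    (t : {U : Set (Germ D) // IsCompactOpenBisection U} → B) : Prop where
  map_empty : ∀ U, U.1 = ∅ → t U = 0
  map_mul : ∀ U W, t U * t W = t ⟨mulSet U.1 W.1, U.2.mul W.2⟩
  map_union : ∀ U W T, Disjoint U.1 W.1 → T.1 = U.1 ∪ W.1 → t U + t W = t T

variable (D)

/-- An `E`-family in a `*`-algebra: mutually orthogonal projections `P_v` and partial isometries
`S_e` with `S_e^* S_f = δ_{e,f} P_{s(e)}` and `P_v = ∑_{r(e) = v} S_e S_e^*`. -/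
structure IsEFamily {A : Type*} [NonUnitalRing A] [StarRing A] (P : V → A) (S : Ed → A) :
    Prop where
  star_proj : ∀ v, star (P v) = P v
  proj_mul_self : ∀ v, P v * P v = P v
  proj_mul_of_ne : ∀ v w, v ≠ w → P v * P w = 0
  partial_isometry : ∀ e, S e * star (S e) * S e = S e
  star_mul_self : ∀ e, star (S e) * S e = P (D.src e)
  star_mul_of_ne : ∀ e f, e ≠ f → star (S e) * S f = 0
  sum : ∀ v, P v = ∑ e ∈ (D.row_finite v).toFinset, S e * star (S e)

open Classical in
/-- A `(G, E)`-family in a `*`-algebra. -/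
structure IsGEFamily {A : Type*} [NonUnitalRing A] [StarRing A] (P : V → G → A) (S : Ed → G → A) :
    Prop where
  isEFamily : IsEFamily D (fun v => P v 1) (fun e => S e 1)
  star_P : ∀ v f, star (P v f) = P (f⁻¹ • v) f⁻¹
  P_mul_P : ∀ v f w h, P v f * P w h = if v = f • w then P v (f * h) else 0
  P_mul_S : ∀ v f e g, P v f * S e g = if v = D.rng (f • e) then S (f • e) (D.φ f e * g) else 0
  S_mul_P : ∀ e g v f, S e g * P v f = if g • v = D.src e then S e (g * f) else 0

/-- Formal `*`-algebra expressions over `R` in the symbols `p_{v,f}` and `s_{e,g}`. -/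
inductive Term (G V Ed R : Type*)
  | p (v : V) (f : G) : Term G V Ed R
  | s (e : Ed) (g : G) : Term G V Ed R
  | zero : Term G V Ed R
  | add (a b : Term G V Ed R) : Term G V Ed R
  | neg (a : Term G V Ed R) : Term G V Ed R
  | mul (a b : Term G V Ed R) : Term G V Ed R
  | smul (r : R) (a : Term G V Ed R) : Term G V Ed R
  | adj (a : Term G V Ed R) : Term G V Ed R

/-- The relations imposed on formal expressions: compatibility with the operations, the axioms of
a (not necessarily unital) `*`-algebra over `R`, and the relations of a `(G, E)`-family. -/
inductive Term.Rel {R : Type*} [CommRing R] [StarRing R] :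
    Term G V Ed R → Term G V Ed R → Prop
  | add_congr_left (a b c) : Rel a b → Rel (.add a c) (.add b c)
  | add_congr_right (a b c) : Rel a b → Rel (.add c a) (.add c b)
  | neg_congr (a b) : Rel a b → Rel (.neg a) (.neg b)
  | mul_congr_left (a b c) : Rel a b → Rel (.mul a c) (.mul b c)
  | mul_congr_right (a b c) : Rel a b → Rel (.mul c a) (.mul c b)
  | smul_congr (r a b) : Rel a b → Rel (.smul r a) (.smul r b)
  | adj_congr (a b) : Rel a b → Rel (.adj a) (.adj b)
  | add_assoc (a b c) : Rel (.add (.add a b) c) (.add a (.add b c))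
  | add_comm (a b) : Rel (.add a b) (.add b a)
  | zero_add (a) : Rel (.add .zero a) a
  | neg_add (a) : Rel (.add (.neg a) a) .zero
  | mul_assoc (a b c) : Rel (.mul (.mul a b) c) (.mul a (.mul b c))
  | mul_add (a b c) : Rel (.mul a (.add b c)) (.add (.mul a b) (.mul a c))
  | add_mul (a b c) : Rel (.mul (.add a b) c) (.add (.mul a c) (.mul b c))
  | one_smul (a) : Rel (.smul 1 a) a
  | mul_smul (r r' a) : Rel (.smul (r * r') a) (.smul r (.smul r' a))
  | smul_add (r a b) : Rel (.smul r (.add a b)) (.add (.smul r a) (.smul r b))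
  | add_smul (r r' a) : Rel (.smul (r + r') a) (.add (.smul r a) (.smul r' a))
  | smul_mul (r a b) : Rel (.mul (.smul r a) b) (.smul r (.mul a b))
  | mul_smul_comm (r a b) : Rel (.mul a (.smul r b)) (.smul r (.mul a b))
  | adj_adj (a) : Rel (.adj (.adj a)) a
  | adj_mul (a b) : Rel (.adj (.mul a b)) (.mul (.adj b) (.adj a))
  | adj_add (a b) : Rel (.adj (.add a b)) (.add (.adj a) (.adj b))
  | adj_smul (r a) : Rel (.adj (.smul r a)) (.smul (star r) (.adj a))
  | adj_proj (v) : Rel (.adj (.p v 1)) (.p v 1)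
  | proj_mul_self (v) : Rel (.mul (.p v 1) (.p v 1)) (.p v 1)
  | proj_mul_of_ne (v w) : v ≠ w → Rel (.mul (.p v 1) (.p w 1)) .zero
  | partial_isometry (e) : Rel (.mul (.mul (.s e 1) (.adj (.s e 1))) (.s e 1)) (.s e 1)
  | adj_mul_self (e) : Rel (.mul (.adj (.s e 1)) (.s e 1)) (.p (D.src e) 1)
  | adj_mul_of_ne (e f) : e ≠ f → Rel (.mul (.adj (.s e 1)) (.s f 1)) .zero
  | sum (v) (l : List Ed) : l.Nodup → (∀ e, e ∈ l ↔ D.rng e = v) →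
      Rel (.p v 1) ((l.map fun e => .mul (.s e 1) (.adj (.s e 1))).foldr .add .zero)
  | adj_p (v f) : Rel (.adj (.p v f)) (.p (f⁻¹ • v) f⁻¹)
  | p_mul_p (v f w h) : v = f • w → Rel (.mul (.p v f) (.p w h)) (.p v (f * h))
  | p_mul_p_zero (v f w h) : v ≠ f • w → Rel (.mul (.p v f) (.p w h)) .zero
  | p_mul_s (v f e g) : v = D.rng (f • e) →
      Rel (.mul (.p v f) (.s e g)) (.s (f • e) (D.φ f e * g))
  | p_mul_s_zero (v f e g) : v ≠ D.rng (f • e) → Rel (.mul (.p v f) (.s e g)) .zero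
  | s_mul_p (e g v f) : g • v = D.src e → Rel (.mul (.s e g) (.p v f)) (.s e (g * f))
  | s_mul_p_zero (e g v f) : g • v ≠ D.src e → Rel (.mul (.s e g) (.p v f)) .zero

/-- The Exel-Pardo `*`-algebra `L_R(G, E)`: the universal `*`-algebra over `R` generated by a
`(G, E)`-family. -/
def ExelPardoAlgebra (R : Type*) [CommRing R] [StarRing R] := Quot (Term.Rel D (R := R))

namespace ExelPardoAlgebra

variable (R : Type*) [CommRing R] [StarRing R]

/-- The generator `p_{v,f}`. -/
def p (v : V) (f : G) : ExelPardoAlgebra D R := Quot.mk _ (.p v f)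

/-- The generator `s_{e,g}`. -/
def s (e : Ed) (g : G) : ExelPardoAlgebra D R := Quot.mk _ (.s e g)

variable {D R}

instance : Zero (ExelPardoAlgebra D R) := ⟨Quot.mk _ .zero⟩

instance : Add (ExelPardoAlgebra D R) :=
  ⟨Quot.map₂ .add (fun a _ _ => .add_congr_right _ _ a) fun _ _ b => .add_congr_left _ _ b⟩

instance : Neg (ExelPardoAlgebra D R) := ⟨Quot.map .neg .neg_congr⟩

instance : Mul (ExelPardoAlgebra D R) :=
  ⟨Quot.map₂ .mul (fun a _ _ => .mul_congr_right _ _ a) fun _ _ b => .mul_congr_left _ _ b⟩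

instance : SMul R (ExelPardoAlgebra D R) := ⟨fun r => Quot.map (.smul r) (.smul_congr r)⟩

instance : Star (ExelPardoAlgebra D R) := ⟨Quot.map .adj .adj_congr⟩

instance : AddCommGroup (ExelPardoAlgebra D R) :=
  have zero_add' : ∀ a : ExelPardoAlgebra D R, 0 + a = a := by
    rintro ⟨a⟩; exact Quot.sound (.zero_add a)
  have add_comm' : ∀ a b : ExelPardoAlgebra D R, a + b = b + a := by
    rintro ⟨a⟩ ⟨b⟩; exact Quot.sound (.add_comm a b)
  { add_assoc := by rintro ⟨a⟩ ⟨b⟩ ⟨c⟩; exact Quot.sound (.add_assoc a b c)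
    zero_add := zero_add'
    add_zero := fun a => (add_comm' a 0).trans (zero_add' a)
    neg_add_cancel := by rintro ⟨a⟩; exact Quot.sound (.neg_add a)
    add_comm := add_comm'
    nsmul := nsmulRec
    zsmul := zsmulRec }

instance : NonUnitalRing (ExelPardoAlgebra D R) :=
  have mul_add' : ∀ a b c : ExelPardoAlgebra D R, a * (b + c) = a * b + a * c := by
    rintro ⟨a⟩ ⟨b⟩ ⟨c⟩; exact Quot.sound (.mul_add a b c)
  have add_mul' : ∀ a b c : ExelPardoAlgebra D R, (a + b) * c = a * c + b * c := by
    rintro ⟨a⟩ ⟨b⟩ ⟨c⟩; exact Quot.sound (.add_mul a b c)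
  { left_distrib := mul_add'
    right_distrib := add_mul'
    zero_mul := fun a => by simpa using add_mul' 0 0 a
    mul_zero := fun a => by simpa using mul_add' a 0 0
    mul_assoc := by rintro ⟨a⟩ ⟨b⟩ ⟨c⟩; exact Quot.sound (.mul_assoc a b c) }

instance : Module R (ExelPardoAlgebra D R) :=
  have smul_add' : ∀ (r : R) (a b : ExelPardoAlgebra D R), r • (a + b) = r • a + r • b := by
    rintro r ⟨a⟩ ⟨b⟩; exact Quot.sound (.smul_add r a b)
  have add_smul' : ∀ (r r' : R) (a : ExelPardoAlgebra D R), (r + r') • a = r • a + r' • a := by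
    rintro r r' ⟨a⟩; exact Quot.sound (.add_smul r r' a)
  { one_smul := by rintro ⟨a⟩; exact Quot.sound (.one_smul a)
    mul_smul := by rintro r r' ⟨a⟩; exact Quot.sound (.mul_smul r r' a)
    smul_add := smul_add'
    add_smul := add_smul'
    smul_zero := fun r => by simpa using smul_add' r 0 0
    zero_smul := fun a => by simpa using add_smul' 0 0 a }

instance : IsScalarTower R (ExelPardoAlgebra D R) (ExelPardoAlgebra D R) :=
  ⟨by rintro r ⟨a⟩ ⟨b⟩; exact Quot.sound (.smul_mul r a b)⟩

instance : SMulCommClass R (ExelPardoAlgebra D R) (ExelPardoAlgebra D R) :=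
  ⟨by rintro r ⟨a⟩ ⟨b⟩; exact (Quot.sound (.mul_smul_comm r a b)).symm⟩

instance : StarRing (ExelPardoAlgebra D R) where
  star_involutive := by rintro ⟨a⟩; exact Quot.sound (.adj_adj a)
  star_mul := by rintro ⟨a⟩ ⟨b⟩; exact Quot.sound (.adj_mul a b)
  star_add := by rintro ⟨a⟩ ⟨b⟩; exact Quot.sound (.adj_add a b)

instance : StarModule R (ExelPardoAlgebra D R) :=
  ⟨by rintro r ⟨a⟩; exact Quot.sound (.adj_smul r a)⟩

variable (D R)

/-- The element `s_{α,g}` for a path `α`, given by its range and its edges: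
`s_{α,g} = s_{e₁,1} ⋯ s_{eₙ₋₁,1} s_{eₙ,g}` for `α = e₁ … eₙ`, and `s_{v,g} = p_{v,g}`. -/
def sList : V → List Ed → G → ExelPardoAlgebra D R
  | v, [], g => p D R v g
  | _, [e], g => s D R e g
  | _, e :: e' :: l, g => s D R e 1 * sList (D.src e) (e' :: l) g

variable {D}

/-- The element `s_{α,g}` for a finite path `α`. -/
def sPath (α : FinPath D) (g : G) : ExelPardoAlgebra D R := sList D R α.r α.edges g

variable (D)

/-- The generators form a `(G, E)`-family. -/
theorem isGEFamily : IsGEFamily D (p D R) (s D R) where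
  isEFamily :=
    { star_proj := fun v => Quot.sound (.adj_proj v)
      proj_mul_self := fun v => Quot.sound (.proj_mul_self v)
      proj_mul_of_ne := fun v w h => Quot.sound (.proj_mul_of_ne v w h)
      partial_isometry := fun e => Quot.sound (.partial_isometry e)
      star_mul_self := fun e => Quot.sound (.adj_mul_self e)
      star_mul_of_ne := fun e f h => Quot.sound (.adj_mul_of_ne e f h)
      sum := fun v => by
        refine (Quot.sound (.sum v (D.row_finite v).toFinset.toList (Finset.nodup_toList _)
          (by simp))).trans ?_
        rw [← Finset.sum_map_toList]
        induction (D.row_finite v).toFinset.toList with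
        | nil => rfl
        | cons e l ih =>
          rw [List.map_cons, List.map_cons, List.foldr_cons, List.sum_cons, ← ih]
          rfl }
  star_P v f := Quot.sound (.adj_p v f)
  P_mul_P v f w h := by
    split_ifs with hv
    · exact Quot.sound (.p_mul_p v f w h hv)
    · exact Quot.sound (.p_mul_p_zero v f w h hv)
  P_mul_S v f e g := by
    split_ifs with hv
    · exact Quot.sound (.p_mul_s v f e g hv)
    · exact Quot.sound (.p_mul_s_zero v f e g hv)
  S_mul_P e g v f := by
    split_ifs with hv
    · exact Quot.sound (.s_mul_p e g v f hv)
    · exact Quot.sound (.s_mul_p_zero e g v f hv)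

/-- The universal property of `L_R(G, E)`. -/
theorem existsUnique_hom {A : Type*} [NonUnitalRing A] [StarRing A] [Module R A]
    [IsScalarTower R A A] [SMulCommClass R A A] [StarModule R A] {P : V → G → A} {S : Ed → G → A}
    (h : IsGEFamily D P S) :
    ∃! π : ExelPardoAlgebra D R →⋆ₙₐ[R] A,
      (∀ v f, π (p D R v f) = P v f) ∧ ∀ e g, π (s D R e g) = S e g := by
  let ev : Term G V Ed R → A := fun a => Term.rec (motive := fun _ => A) (fun v f => P v f)
    (fun e g => S e g) 0 (fun _ _ x y => x + y) (fun _ x => -x) (fun _ _ x y => x * y)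
    (fun r _ x => r • x) (fun _ x => star x) a
  have hev : ∀ a b, Term.Rel D a b → ev a = ev b := by
    intro a b hab
    induction hab with
    | add_congr_left a b c _ ih => exact congrArg (· + ev c) ih
    | add_congr_right a b c _ ih => exact congrArg (ev c + ·) ih
    | neg_congr a b _ ih => exact congrArg (-·) ih
    | mul_congr_left a b c _ ih => exact congrArg (· * ev c) ih
    | mul_congr_right a b c _ ih => exact congrArg (ev c * ·) ih
    | smul_congr r a b _ ih => exact congrArg (r • ·) ih
    | adj_congr a b _ ih => exact congrArg star ih
    | add_assoc a b c => exact _root_.add_assoc (ev a) (ev b) (ev c)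
    | add_comm a b => exact _root_.add_comm (ev a) (ev b)
    | zero_add a => exact _root_.zero_add (ev a)
    | neg_add a => exact neg_add_cancel (ev a)
    | mul_assoc a b c => exact _root_.mul_assoc (ev a) (ev b) (ev c)
    | mul_add a b c => exact _root_.mul_add (ev a) (ev b) (ev c)
    | add_mul a b c => exact _root_.add_mul (ev a) (ev b) (ev c)
    | one_smul a => exact _root_.one_smul R (ev a)
    | mul_smul r r' a => exact SemigroupAction.mul_smul r r' (ev a)
    | smul_add r a b => exact _root_.smul_add r (ev a) (ev b)
    | add_smul r r' a => exact _root_.add_smul r r' (ev a)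
    | smul_mul r a b => exact smul_mul_assoc r (ev a) (ev b)
    | mul_smul_comm r a b => exact _root_.mul_smul_comm r (ev a) (ev b)
    | adj_adj a => exact star_star (ev a)
    | adj_mul a b => exact star_mul (ev a) (ev b)
    | adj_add a b => exact star_add (ev a) (ev b)
    | adj_smul r a => exact star_smul r (ev a)
    | adj_proj v => exact h.isEFamily.star_proj v
    | proj_mul_self v => exact h.isEFamily.proj_mul_self v
    | proj_mul_of_ne v w hv => exact h.isEFamily.proj_mul_of_ne v w hv
    | partial_isometry e => exact h.isEFamily.partial_isometry e
    | adj_mul_self e => exact h.isEFamily.star_mul_self e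
    | adj_mul_of_ne e f he => exact h.isEFamily.star_mul_of_ne e f he
    | sum v l hl hm =>
      classical
      have h1 : (D.row_finite v).toFinset = l.toFinset := by
        ext e
        simp [hm]
      refine (h.isEFamily.sum v).trans ?_
      rw [h1, List.sum_toFinset _ hl]
      clear h1 hm hl
      induction l with
      | nil => rfl
      | cons e l ih => exact congrArg (S e 1 * star (S e 1) + ·) ih
    | adj_p v f => exact h.star_P v f
    | p_mul_p v f w k hv => exact (h.P_mul_P v f w k).trans (if_pos hv)
    | p_mul_p_zero v f w k hv => exact (h.P_mul_P v f w k).trans (if_neg hv)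
    | p_mul_s v f e g hv => exact (h.P_mul_S v f e g).trans (if_pos hv)
    | p_mul_s_zero v f e g hv => exact (h.P_mul_S v f e g).trans (if_neg hv)
    | s_mul_p e g v f hv => exact (h.S_mul_P e g v f).trans (if_pos hv)
    | s_mul_p_zero e g v f hv => exact (h.S_mul_P e g v f).trans (if_neg hv)
  refine ⟨{ toFun := Quot.lift ev hev
            map_smul' := by rintro r ⟨a⟩; rfl
            map_zero' := rfl
            map_add' := by rintro ⟨a⟩ ⟨b⟩; rfl
            map_mul' := by rintro ⟨a⟩ ⟨b⟩; rfl
            map_star' := by rintro ⟨a⟩; rfl }, ⟨fun _ _ => rfl, fun _ _ => rfl⟩, ?_⟩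
  rintro π ⟨h1, h2⟩
  ext ⟨a⟩
  let mk : Term G V Ed R → ExelPardoAlgebra D R := Quot.mk _
  change π (mk a) = ev a
  induction a with
  | p v f => exact h1 v f
  | s e g => exact h2 e g
  | zero => exact map_zero π
  | add a b ha hb => exact (map_add π (mk a) (mk b)).trans (congrArg₂ _ ha hb)
  | neg a ha => exact (map_neg π (mk a)).trans (congrArg _ ha)
  | mul a b ha hb => exact (map_mul π (mk a) (mk b)).trans (congrArg₂ _ ha hb)
  | smul r a ha => exact (map_smul π r (mk a)).trans (congrArg _ ha)
  | adj a ha => exact (map_star π (mk a)).trans (congrArg _ ha)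

end ExelPardoAlgebra

end

end ExelPardo

/-! ### Restrictions of triples to smaller cylinder sets -/

namespace ExelPardo

section

variable {G V Ed : Type*} [Group G] [MulAction G V] [MulAction G Ed]
  {D : SelfSimilarGraph G V Ed}

open SelfSimilarGraph

/-! The indicator functions of the sets `Θ_s` multiply like the elements of `S_{G,E}`, so those of
the generating triples satisfy the relations of a `(G, E)`-family, and the universal property gives
`π`. It sends `s_{α,g} s_{β,1}^*` to the indicator function of `Θ_{(α,g,β)}`. These products span
`L_R(G, E)` (`span_range_ofTriple`), so both injectivity and surjectivity are questions about how
the sets `Θ_s` overlap.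

The relation `p_{s(β)} = ∑ s_e s_e^*` rewrites `s_{α,g} s_{β,1}^*` as the sum of the elements
`s_{α(g·e),φ(g,e)} s_{βe,1}^*`, that is, as a sum over restrictions of `(α, g, β)` to smaller
cylinder sets. Hence the third entries of finitely many triples can be brought to one common length
`N`. Two distinct triples with the same third entry may still share some germs, because `g` and `h`
can agree after a long initial segment of one infinite path and not of another. This is the
obstruction to linear independence.

In the Hausdorff case the obstruction disappears for large `N`. The set `Θ_s ∩ Θ_t` is then compact,
and it is covered by the open sets `Θ_w` with `w` a common restriction of `s` and `t`; finitely many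
`w` suffice. Once `N` exceeds the lengths of their third entries, a restriction of `s` and a
restriction of `t` at length `N` that share a germ both restrict the same `w`, and therefore
coincide (`exists_length_pair`, `exists_length`).

Consequently every element of `L_R(G, E)` is a combination of products `s_{α,g} s_{β,1}^*` with
pairwise disjoint nonempty germ sets. Indicator functions of such sets are linearly independent over
any `R`, so `π` is injective. Likewise every compact open bisection is a finite disjoint union of
sets `Θ_s`, so `π` is surjective. The family is `t_U = π⁻¹(1_U)`, and its properties are those of
indicator functions. -/

theorem FinPath.Z_nonempty (β : FinPath D) : β.Z.Nonempty := by
  choose next hnext using D.no_sources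
  -- As there are no sources, an edge `next v` with range `v` can be chosen for each vertex;
  -- following these edges from `s(β)` gives an infinite path.
  let x : InfPath D := ⟨fun n => next ((fun v => D.src (next v))^[n] β.s), fun n => by
    change _ = D.rng (next ((fun v => D.src (next v))^[n + 1] β.s))
    rw [hnext, Function.iterate_succ_apply']
    rfl⟩
  have hx : β.s = x.r := (hnext β.s).symm
  exact ⟨β.concat x hx, x, hx, rfl⟩

theorem FinPath.eq_of_mem_Z {β γ : FinPath D} {x : InfPath D} (hβ : x ∈ β.Z) (hγ : x ∈ γ.Z)
    (h : β.length = γ.length) : β = γ := by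
  rw [eq_pre hβ, eq_pre hγ, h]

namespace Triple

/-- `u = (α(g·w), φ(g, w), βw)` is the restriction of `s = (α, g, β)` to the cylinder set of its
third entry. -/
def Restricts (u s : Triple D) : Prop :=
  ∃ w, u.a.r = s.a.r ∧ u.a.edges = s.a.edges ++ D.actL s.g w ∧ u.g = D.cocL s.g w ∧
    u.b.r = s.b.r ∧ u.b.edges = s.b.edges ++ w

namespace Restricts

variable {s u v w : Triple D}

theorem refl (s : Triple D) : s.Restricts s := ⟨[], by simp [actL, cocL]⟩

theorem trans (huv : u.Restricts v) (hvs : v.Restricts s) : u.Restricts s := by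
  obtain ⟨l, h1, h2, h3, h4, h5⟩ := huv
  obtain ⟨m, k1, k2, k3, k4, k5⟩ := hvs
  exact ⟨m ++ l, h1.trans k1, by rw [h2, k2, k3, actL_append, List.append_assoc],
    by rw [h3, k3, cocL_append], h4.trans k4, by rw [h5, k5, List.append_assoc]⟩

/-- The word `w` is recovered from the third entry by cancelling `β`, and `w` determines the other
two entries. -/
theorem eq_of_b_eq (hu : u.Restricts s) (hv : v.Restricts s) (h : u.b = v.b) : u = v := by
  obtain ⟨l, h1, h2, h3, h4, h5⟩ := hu
  obtain ⟨m, k1, k2, k3, k4, k5⟩ := hv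
  obtain rfl : l = m :=
    List.append_cancel_left (h5.symm.trans ((congrArg FinPath.edges h).trans k5))
  exact Triple.ext (FinPath.ext (h1.trans k1.symm) (h2.trans k2.symm)) (h3.trans k3.symm) h

/-- Both third entries are initial segments of the same `y`, so the longer one extends the shorter.
The two extensions of `s` are then comparable, and the cocycle identities for concatenated words
give the remaining entries. -/
theorem of_mem_Z (hu : u.Restricts s) (hw : w.Restricts s) {y : InfPath D} (hyu : y ∈ u.b.Z)
    (hyw : y ∈ w.b.Z) (hl : w.b.length ≤ u.b.length) : u.Restricts w := by
  obtain ⟨k, hk⟩ := Nat.exists_eq_add_of_le hl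
  have he := FinPath.edges_eq hyu
  rw [hk, Stream'.take_add, ← FinPath.edges_eq hyw] at he
  set r := (y.seq.drop w.b.length).take k
  obtain ⟨l, h1, h2, h3, h4, h5⟩ := hu
  obtain ⟨m, k1, k2, k3, k4, k5⟩ := hw
  obtain rfl : l = m ++ r := by
    rw [h5, k5, List.append_assoc] at he
    exact List.append_cancel_left he
  exact ⟨r, h1.trans k1.symm, by rw [h2, k2, k3, actL_append, List.append_assoc],
    by rw [h3, k3, cocL_append], h4.trans k4.symm, he⟩

theorem mem_Z (hu : u.Restricts s) {y : InfPath D} (hy : y ∈ u.b.Z) : y ∈ s.b.Z := by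
  obtain ⟨l, -, -, -, h4, h5⟩ := hu
  have := FinPath.edges_eq hy
  unfold FinPath.length at this
  rw [h5] at this
  exact FinPath.mem_Z_of_take ((FinPath.r_eq hy).symm.trans h4) this.symm

theorem eq_idem {β : FinPath D} (h : u.Restricts (idem β)) :
    u = idem u.b := by
  obtain ⟨w, h1, h2, h3, h4, h5⟩ := h
  exact Triple.ext (FinPath.ext (h1.trans h4.symm) (h2.trans (by simp [idem, h5])))
    (h3.trans (by simp [idem])) rfl

end Restricts

end Triple

theorem PreGerm.trip_restricts (p : PreGerm D) {n m : ℕ} {g : G} (h : p.Data n m g) :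
    (p.trip h).Restricts p.s := by
  obtain ⟨k, rfl, rfl, rfl⟩ := id h
  refine ⟨(p.x.seq.drop p.s.b.length).take k, r_tgt p, take_tgt k, rfl,
    (FinPath.r_eq p.hx).symm, ?_⟩
  rw [FinPath.edges_eq p.hx]
  exact Stream'.take_add _ _ _

/-! ### Overlaps of the sets `Θ_s` in the Hausdorff case -/

namespace Germ

open PreGerm

/-- The third entry of `u` consists of the first `n` edges of the source of the germ. As `n` is
prescribed, restrictions of several triples can be put at one common length. -/
theorem exists_restricts {s : Triple D} {c : Germ D} (hc : c ∈ theta s) {n : ℕ}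
    (hn : s.b.length ≤ n) : ∃ u : Triple D, u.Restricts s ∧ u.b.length = n ∧ c ∈ theta u := by
  obtain ⟨x, hx, -, rfl⟩ := hc
  obtain ⟨k, rfl⟩ := Nat.exists_eq_add_of_le hn
  have hd := (data_self ⟨s, x, hx⟩).shift k
  refine ⟨_, trip_restricts _ hd, by simp [trip, InfPath.pre, FinPath.length], ?_⟩
  obtain ⟨h1, h2⟩ := mk_trip hd (x.mem_Z_pre _)
  exact ⟨x, x.mem_Z_pre _, x.mem_Z_pre _, h2⟩

/-- For `x` in the smaller cylinder set, the germ `[s, x]` lies in `Θ` of some restriction of `s`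
with third entry as long as that of `u`. Both third entries are initial segments of `x`, so this
restriction is `u`, and `[u, x] = [s, x]`. -/
theorem theta_subset {u s : Triple D} (h : u.Restricts s) : theta u ⊆ theta s := by
  rintro _ ⟨x, hx, -, rfl⟩
  have hs := h.mem_Z hx
  have hl : s.b.length ≤ u.b.length := by
    obtain ⟨w, -, -, -, -, h5⟩ := h
    simp [FinPath.length, h5]
  obtain ⟨u', h1, h2, h3⟩ := exists_restricts (s := s) (c := mk s x hs) ⟨x, hs, hs, rfl⟩ hl
  obtain ⟨hx', h4⟩ := mem_theta_iff.1 h3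
  obtain rfl := h1.eq_of_b_eq h (FinPath.eq_of_mem_Z hx' hx h2)
  exact ⟨x, hs, hs, h4.symm⟩

/-- Equality of the germs `[s, x] = [t, x]` means `se = te` for an idempotent `e` of an initial
segment of `x`; for a long enough segment, this product is the common restriction. -/
theorem exists_common_restricts {s t : Triple D} {c : Germ D} (hs : c ∈ theta s)
    (ht : c ∈ theta t) : ∃ w : Triple D, w.Restricts s ∧ w.Restricts t ∧ c ∈ theta w := by
  obtain ⟨x, hx, -, rfl⟩ := hs
  obtain ⟨y, hy, -, h⟩ := ht
  obtain ⟨h1, h2, n, m, g, hp, hq⟩ := (rel_iff _ _).1 (Quotient.exact h)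
  obtain rfl : x = y := h1
  have he : (PreGerm.mk s x hx).trip hp = (PreGerm.mk t x hy).trip hq := by
    unfold trip
    congr 2
  refine ⟨_, trip_restricts _ hp, he ▸ trip_restricts _ hq, ?_⟩
  obtain ⟨k1, k2⟩ := mk_trip hp (x.mem_Z_pre n)
  exact ⟨x, x.mem_Z_pre n, x.mem_Z_pre n, k2⟩

theorem theta_nonempty (s : Triple D) : (theta s).Nonempty :=
  let ⟨x, hx⟩ := s.b.Z_nonempty
  ⟨mk s x hx, x, hx, hx, rfl⟩

/-- In the Hausdorff case restrictions of two triples to cylinder sets of a common large length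
coincide or have disjoint sets of germs. -/
theorem exists_length_pair [T2Space (Germ D)] (s t : Triple D) :
    ∃ N, ∀ u v : Triple D, u.Restricts s → v.Restricts t → N ≤ u.b.length →
      u.b.length = v.b.length → u = v ∨ Disjoint (theta u) (theta v) := by
  -- The Hausdorff property enters the whole argument here: without it an intersection of two
  -- compact sets need not be compact.
  have hK : IsCompact (theta s ∩ theta t) := (isCompact_theta s).inter (isCompact_theta t)
  obtain ⟨F, hF⟩ := hK.elim_finite_subcover
    (fun w : {w : Triple D // w.Restricts s ∧ w.Restricts t} => theta w.1)
    (fun w => isOpen_theta _) fun c hc => by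
      obtain ⟨w, h1, h2, h3⟩ := exists_common_restricts hc.1 hc.2
      exact Set.mem_iUnion.2 ⟨⟨w, h1, h2⟩, h3⟩
  -- The bound is the greatest length of a third entry in the finite cover; it is `0` if the cover
  -- is empty, and then `Θ_s` and `Θ_t` are disjoint.
  refine ⟨F.sup fun w => w.1.b.length, fun u v hu hv hN huv => or_iff_not_imp_right.2 fun hd => ?_⟩
  obtain ⟨c, hcu, hcv⟩ := Set.not_disjoint_iff.1 hd
  obtain ⟨w, hw, hcw⟩ := Set.mem_iUnion₂.1 (hF ⟨theta_subset hu hcu, theta_subset hv hcv⟩)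
  have hwN := (Finset.le_sup (f := fun w : {w : Triple D // w.Restricts s ∧ w.Restricts t} =>
    w.1.b.length) hw).trans hN
  obtain ⟨yu, -⟩ := mem_theta_iff.1 hcu
  obtain ⟨yv, -⟩ := mem_theta_iff.1 hcv
  obtain ⟨yw, -⟩ := mem_theta_iff.1 hcw
  -- Since `w` restricts both `s` and `t`, and `u`, `v` are at least as long, both restrict `w`.
  -- Their third entries have equal length and contain a common infinite path in their cylinder
  -- sets, so they agree.
  exact (hu.of_mem_Z w.2.1 yu yw hwN).eq_of_b_eq (hv.of_mem_Z w.2.2 yv yw (huv ▸ hwN))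
    (FinPath.eq_of_mem_Z yu yv huv)

theorem exists_length [T2Space (Germ D)] {A : Set (Triple D)} (hA : A.Finite) :
    ∃ N, (∀ s ∈ A, s.b.length ≤ N) ∧
      {u : Triple D | u.b.length = N ∧ ∃ s ∈ A, u.Restricts s}.PairwiseDisjoint theta := by
  choose N hN using exists_length_pair (D := D)
  obtain ⟨M, hM⟩ := ((hA.prod hA).image fun p => N p.1 p.2).bddAbove
  obtain ⟨K, hK⟩ := (hA.image fun s => s.b.length).bddAbove
  -- `K` makes every triple of `A` extendable to this length, and `M` dominates the bounds for all
  -- pairs from `A`, including pairs `(s, s)`.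
  refine ⟨K + M, fun s hs => (hK ⟨s, hs, rfl⟩).trans (by omega), ?_⟩
  rintro u ⟨hu, s, hs, hus⟩ v ⟨hv, t, ht, hvt⟩ huv
  refine (hN s t u v hus hvt ?_ (hu.trans hv.symm)).resolve_left huv
  have := hM ⟨(s, t), ⟨hs, ht⟩, rfl⟩
  simp only at this
  omega

/-- In the Hausdorff case compact open bisections are finite disjoint unions of sets `Θ_s`. -/
theorem exists_finset_eq_iUnion_theta [T2Space (Germ D)] {U : Set (Germ D)}
    (hU : IsCompactOpenBisection U) : ∃ J : Finset (Triple D),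
      (J : Set (Triple D)).PairwiseDisjoint theta ∧ U = ⋃ s ∈ J, theta s := by
  obtain ⟨A, hA, hUA⟩ := (isCompact_isOpen_iff U).1 ⟨hU.1, hU.2⟩
  obtain ⟨N, hN, hd⟩ := exists_length hA
  -- Compactness of `U` yields a finite family without counting paths. The union of the chosen sets
  -- does not exceed `U`, because each of them restricts some `Θ_s ⊆ U`.
  obtain ⟨J, hJ, hJf, hUJ⟩ := hU.1.elim_finite_subcover_image (fun u _ => isOpen_theta u)
    (b := {u : Triple D | u.b.length = N ∧ ∃ s ∈ A, u.Restricts s}) fun c hc => by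
      rw [hUA] at hc
      obtain ⟨s, hs, hcs⟩ := Set.mem_iUnion₂.1 hc
      obtain ⟨u, h1, h2, h3⟩ := exists_restricts hcs (hN s hs)
      exact Set.mem_iUnion₂.2 ⟨u, ⟨h2, s, hs, h1⟩, h3⟩
  refine ⟨hJf.toFinset, by simpa using hd.subset hJ, ?_⟩
  simp only [Set.Finite.mem_toFinset]
  refine hUJ.antisymm (Set.iUnion₂_subset fun u hu => ?_)
  obtain ⟨-, s, hs, hus⟩ := hJ hu
  rw [hUA]
  exact (theta_subset hus).trans (Set.subset_biUnion_of_mem (u := theta) hs)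

end Germ

end

end ExelPardo

/-! ### The `(G, E)`-family of indicator functions -/

namespace ExelPardo

section

variable {G V Ed : Type*} [Group G] [MulAction G V] [MulAction G Ed]
  {D : SelfSimilarGraph G V Ed} {R : Type*}

open SelfSimilarGraph ExelPardo.Germ

namespace SteinbergAlgebra

section

variable [CommRing R]

theorem char_congr {U W : Set (Germ D)} (h : U = W) (hU : IsCompactOpenBisection U)
    (hW : IsCompactOpenBisection W) : char R U hU = char R W hW := by
  subst h
  rfl

theorem char_eq_zero {U : Set (Germ D)} (h : U = ∅) (hU : IsCompactOpenBisection U) :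
    char R U hU = 0 := by
  subst h
  exact Subtype.ext (Set.indicator_empty _)

theorem char_mul {U W : Set (Germ D)} (hU : IsCompactOpenBisection U)
    (hW : IsCompactOpenBisection W) : char R U hU * char R W hW = char R _ (hU.mul hW) :=
  Subtype.ext (conv_indicator hU hW)

theorem char_union {U W T : Set (Germ D)} (hU : IsCompactOpenBisection U)
    (hW : IsCompactOpenBisection W) (hT : IsCompactOpenBisection T) (hd : Disjoint U W)
    (h : T = U ∪ W) : char R U hU + char R W hW = char R T hT := by
  subst h
  exact Subtype.ext (Set.indicator_union_of_disjoint (M := R) hd (1 : Germ D → R)).symm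

/-- The inclusion of the Steinberg algebra into the space of functions. -/
noncomputable def toFunₗ : SteinbergAlgebra D R →ₗ[R] (Germ D → R) :=
  (steinbergModule D R).subtype

theorem char_eq_sum {U : Set (Germ D)} (hU : IsCompactOpenBisection U) (J : Finset (Triple D))
    (hd : (J : Set (Triple D)).PairwiseDisjoint theta) (h : U = ⋃ s ∈ J, theta s) :
    char R U hU = ∑ s ∈ J, char R (theta s) (isCompactOpenBisection_theta s) := by
  refine Subtype.ext (Eq.trans ?_ (map_sum (toFunₗ (R := R) (D := D)) _ _).symm)
  subst h
  exact (Finset.indicator_biUnion J theta fun s hs t ht hst => hd hs ht hst).trans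
    (by ext c; rw [Finset.sum_apply]; rfl)

variable (R) in
/-- The characteristic functions of the sets `Θ_s` as a map on `S_{G,E}`. -/
noncomputable def ofSGE : SGE D → SteinbergAlgebra D R
  | .zero => 0
  | .of s => char R (theta s) (isCompactOpenBisection_theta s)

/-- This reduces the relations between indicator functions to products in `S_{G,E}`, with the zero
of `S_{G,E}` accounting for the vanishing products. -/
theorem ofSGE_mul (s t : Triple D) : ofSGE R (.of s) * ofSGE R (.of t) =
    ofSGE R (SGE.of s * SGE.of t) := by
  rcases h : SGE.of s * SGE.of t with _ | u
  · exact (char_mul (isCompactOpenBisection_theta s) (isCompactOpenBisection_theta t)).trans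
      (char_eq_zero (mulSet_theta_zero h) _)
  · exact (char_mul (isCompactOpenBisection_theta s) (isCompactOpenBisection_theta t)).trans
      (char_congr (mulSet_theta_of h) _ (isCompactOpenBisection_theta u))

theorem star_ofSGE [StarRing R] (s : Triple D) :
    star (ofSGE R (.of s)) = ofSGE R (.of s.adj) := by
  classical
  refine Subtype.ext (funext fun c => ?_)
  change star ((theta s).indicator 1 c⁻¹) = (theta s.adj).indicator (1 : Germ D → R) c
  by_cases hc : c ∈ theta s.adj
  · rw [Set.indicator_of_mem hc, Set.indicator_of_mem (inv_mem_theta.2 hc)]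
    simp
  · rw [Set.indicator_of_notMem hc, Set.indicator_of_notMem (mt inv_mem_theta.1 hc)]
    simp

end

end SteinbergAlgebra

theorem Triple.of_mul_eq_zero {s t : Triple D}
    (h1 : ∀ w, t.a.r = s.b.r → t.a.edges ≠ s.b.edges ++ w)
    (h2 : ∀ w, s.b.r = t.a.r → s.b.edges ≠ t.a.edges ++ w) :
    SGE.of s * SGE.of t = SGE.zero := by
  rcases h : SGE.of s * SGE.of t with _ | u
  · rfl
  · rcases Triple.mul_eq_of h with ⟨w, k1, k2⟩ | ⟨w, k1, k2⟩
    exacts [(h1 w k1 k2).elim, (h2 w k1 k2).elim]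

/-- The product is defined through a chosen path `ε`; here it is identified by comparing entries.
The case `γ = βε` covers every nonzero product computed below, mostly with `ε` of length `0`. -/
theorem Triple.of_mul_eq {s t u : Triple D} (w : List Ed) (hr : t.a.r = s.b.r)
    (he : t.a.edges = s.b.edges ++ w) (h1 : u.a.r = s.a.r)
    (h2 : u.a.edges = s.a.edges ++ D.actL s.g w) (h3 : u.g = D.cocL s.g w * t.g)
    (h4 : u.b = t.b) : SGE.of s * SGE.of t = SGE.of u := by
  obtain ⟨u', h, k1, k2, k3, k4⟩ := Triple.mul_of_append hr he
  rw [h]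
  exact congrArg _ (Triple.ext (FinPath.ext (k1.trans h1.symm) (k2.trans h2.symm))
    (k3.trans h3.symm) (k4.trans h4.symm))

namespace SteinbergAlgebra

variable [CommRing R] [StarRing R]

open Triple

theorem star_edge_mul_edge (e : Ed) : SGE.of (ofEdge D e 1).adj * SGE.of (ofEdge D e 1) =
    SGE.of (ofVertex D (D.src e) 1) := by
  refine of_mul_eq [] rfl (by simp [ofEdge, Triple.adj]) ?_ ?_ ?_ ?_ <;>
    simp [ofEdge, ofVertex, Triple.adj, FinPath.vertex, actL, cocL]

theorem edge_mul_star_edge (e : Ed) : SGE.of (ofEdge D e 1) * SGE.of (ofEdge D e 1).adj =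
    SGE.of (idem (.edge D e)) := by
  refine of_mul_eq [] rfl (by simp [ofEdge, Triple.adj]) ?_ ?_ ?_ ?_ <;>
    simp [ofEdge, idem, Triple.adj, actL, cocL]

theorem idem_edge_mul_edge (e : Ed) : SGE.of (idem (.edge D e)) * SGE.of (ofEdge D e 1) =
    SGE.of (ofEdge D e 1) := by
  refine of_mul_eq [] rfl (by simp [ofEdge, idem]) ?_ ?_ ?_ ?_ <;>
    simp [ofEdge, idem, actL, cocL]

theorem ofVertex_one (v : V) : ofVertex D v 1 = idem (.vertex D v) :=
  Triple.ext rfl rfl (by simp [ofVertex, idem])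

/-- This is the source of the relation `P_v = ∑ S_e S_e^*`: each germ in `Θ_{(v,1,v)}` lies in `Θ`
of a restriction at length `1`, and restrictions of idempotents are idempotents, here `(e, 1, e)`
with `r(e) = v`. -/
theorem theta_vertex_eq (v : V) : theta (ofVertex D v 1) =
    ⋃ e ∈ (D.row_finite v).toFinset, theta (idem (.edge D e)) := by
  rw [ofVertex_one]
  ext c
  simp only [Set.mem_iUnion, Set.Finite.mem_toFinset]
  constructor
  · intro hc
    obtain ⟨u, h1, h2, h3⟩ := exists_restricts (n := 1) hc (by simp [idem, FinPath.vertex,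
      FinPath.length])
    rw [h1.eq_idem] at h3
    obtain ⟨e, he⟩ := List.length_eq_one_iff.1 h2
    have hr : D.rng e = u.b.r := by
      have := u.b.isPath
      rw [he] at this
      exact this.1
    have hub : u.b = .edge D e := FinPath.ext hr.symm he
    obtain ⟨w, -, -, -, h4, -⟩ := h1
    exact ⟨e, hr.trans h4, hub ▸ h3⟩
  · rintro ⟨e, he, hc⟩
    refine theta_subset ?_ hc
    refine ⟨[e], he, ?_, ?_, he, ?_⟩ <;> simp [idem, FinPath.edge, FinPath.vertex]

theorem disjoint_theta_edge {e f : Ed} (h : e ≠ f) :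
    Disjoint (theta (idem (.edge D e))) (theta (idem (.edge D f))) := by
  refine Set.disjoint_left.2 fun c hc hc' => h ?_
  obtain ⟨h1, -⟩ := mem_theta_iff.1 hc
  obtain ⟨h2, -⟩ := mem_theta_iff.1 hc'
  have := congrArg FinPath.edges (FinPath.eq_of_mem_Z h1 h2 rfl)
  simpa [idem, FinPath.edge] using this

variable (D R) in
/-- The characteristic functions of the sets `Θ_{(v,f,f⁻¹·v)}` and `Θ_{(e,g,g⁻¹·s(e))}` form a
`(G, E)`-family. -/
theorem isGEFamily : IsGEFamily D (fun v f => ofSGE R (.of (ofVertex D v f)))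
    (fun e g => ofSGE R (.of (ofEdge D e g))) := by
  classical
  have hPP : ∀ v f w h, ofSGE R (.of (ofVertex D v f)) * ofSGE R (.of (ofVertex D w h)) =
      if v = f • w then ofSGE R (.of (ofVertex D v (f * h))) else 0 := by
    intro v f w h
    rw [ofSGE_mul]
    split_ifs with hv
    · subst hv
      rw [of_mul_eq (u := ofVertex D (f • w) (f * h)) []] <;>
        simp [ofVertex, FinPath.vertex, actL, cocL, mul_smul]
    -- Either nonzero case of the product would force the third entry `f⁻¹ · v` of the left factor
    -- and the first entry of the right factor to have the same range.
    · have : w ≠ f⁻¹ • v := fun h => hv (by rw [h, smul_inv_smul])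
      rw [of_mul_eq_zero]
      · rfl
      · exact fun _ h => (this h).elim
      · exact fun _ h => (this h.symm).elim
  have hstar : ∀ v f, star (ofSGE R (.of (ofVertex D v f))) =
      ofSGE R (.of (ofVertex D (f⁻¹ • v) f⁻¹)) := by
    intro v f
    rw [star_ofSGE]
    exact congrArg (fun s => ofSGE R (.of s))
      (Triple.ext rfl rfl (by simp [Triple.adj, ofVertex]))
  refine ⟨⟨fun v => ?_, fun v => ?_, fun v w h => ?_, fun e => ?_, fun e => ?_, fun e f h => ?_,
    fun v => ?_⟩, hstar, hPP, fun v f e g => ?_, fun e g v f => ?_⟩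
  · simpa using hstar v 1
  · simpa using hPP v 1 v 1
  · simpa [h] using hPP v 1 w 1
  · rw [star_ofSGE, ofSGE_mul, edge_mul_star_edge, ofSGE_mul, idem_edge_mul_edge]
  · rw [star_ofSGE, ofSGE_mul, star_edge_mul_edge]
  · rw [star_ofSGE, ofSGE_mul, of_mul_eq_zero]
    · rfl
    · simp [ofEdge, Triple.adj, FinPath.edge, h.symm]
    · simp [ofEdge, Triple.adj, FinPath.edge, h]
  · simp only [star_ofSGE, ofSGE_mul, edge_mul_star_edge]
    -- `char_eq_sum` sums over a finite set of triples, so the sum over edges is reindexed along `e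
    -- ↦ (e, 1, e)`.
    have hinj : Set.InjOn (fun e => idem (.edge D e)) (D.row_finite v).toFinset :=
      fun e _ f _ hef => by
        simpa [idem, FinPath.edge] using congrArg (fun s => s.a.edges) hef
    refine (char_eq_sum (isCompactOpenBisection_theta _) ((D.row_finite v).toFinset.image fun e => idem (.edge D e)) ?_
      ?_).trans (Finset.sum_image hinj)
    · rw [Finset.coe_image]
      rintro _ ⟨e, -, rfl⟩ _ ⟨f, -, rfl⟩ hef
      exact disjoint_theta_edge fun h => hef (by rw [h])
    · rw [theta_vertex_eq, Finset.set_biUnion_finset_image]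
  · rw [ofSGE_mul]
    split_ifs with hv
    · subst hv
      -- The third entries agree because `φ(f, e)` acts on vertices in the same way as `f`.
      have hb : (D.φ f e * g)⁻¹ • D.src (f • e) = g⁻¹ • D.src e := by
        rw [D.src_smul, mul_inv_rev, mul_smul, ← D.φ_smul f e, inv_smul_smul]
      rw [of_mul_eq (u := ofEdge D (f • e) (D.φ f e * g)) [e]]
      · simp [ofVertex, ofEdge, FinPath.vertex, FinPath.edge, D.rng_smul]
      · simp [ofVertex, ofEdge, FinPath.vertex, FinPath.edge]
      · rfl
      · rfl
      · rfl
      · exact FinPath.ext hb rfl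
    · have : D.rng e ≠ f⁻¹ • v := fun h => hv (by rw [D.rng_smul, h, smul_inv_smul])
      rw [of_mul_eq_zero]
      · rfl
      · exact fun _ h => (this h).elim
      · exact fun _ h => (this h.symm).elim
  · rw [ofSGE_mul]
    split_ifs with hv
    · rw [of_mul_eq (u := ofEdge D e (g * f)) []] <;>
        simp [ofVertex, ofEdge, FinPath.vertex, FinPath.edge, actL, cocL, mul_smul, ← hv]
    · have : v ≠ g⁻¹ • D.src e := fun h => hv (by rw [h, smul_inv_smul])
      rw [of_mul_eq_zero]
      · rfl
      · exact fun _ h => (this h).elim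
      · exact fun _ h => (this h.symm).elim

end SteinbergAlgebra

end

end ExelPardo

/-! ### The spanning elements `s_{α,g} s_{β,1}^*` of `L_R(G, E)` -/

namespace ExelPardo

section

variable {G V Ed : Type*} [Group G] [MulAction G V] [MulAction G Ed]
  {D : SelfSimilarGraph G V Ed} {R : Type*}

open SelfSimilarGraph

namespace ExelPardoAlgebra

variable [CommRing R] [StarRing R]

theorem s_mul_p_src (e : Ed) (g : G) : s D R e 1 * p D R (D.src e) g = s D R e g := by
  simpa using (isGEFamily D R).S_mul_P e 1 (D.src e) g

/-- The definition of `sList` singles out the last edge. Since `s_{e,g} = s_{e,1} p_{s(e),g}`, the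
recursion has this uniform form, which also covers an empty tail and serves all inductions on paths.
-/
theorem sList_cons (v : V) (e : Ed) (l : List Ed) (g : G) :
    sList D R v (e :: l) g = s D R e 1 * sList D R (D.src e) l g := by
  cases l with
  | nil => exact (s_mul_p_src e g).symm
  | cons e' l => rfl

theorem sList_mul_p (v : V) (l : List Ed) (g f : G) :
    sList D R v l g * p D R (g⁻¹ • D.endpoint v l) f = sList D R v l (g * f) := by
  induction l generalizing v with
  | nil => simpa [sList, endpoint] using (isGEFamily D R).P_mul_P v g (g⁻¹ • v) f
  | cons e l ih => rw [sList_cons, sList_cons, mul_assoc, endpoint, ih]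

theorem sList_one_mul_p (v : V) (l : List Ed) (g : G) :
    sList D R v l 1 * p D R (D.endpoint v l) g = sList D R v l g := by
  simpa using sList_mul_p (R := R) v l 1 g

theorem p_mul_sList_of_ne {w v : V} {f : G} {l : List Ed} (hl : D.IsPath v l) (g : G)
    (h : w ≠ f • v) : p D R w f * sList D R v l g = 0 := by
  cases l with
  | nil => exact ((isGEFamily D R).P_mul_P w f v g).trans (if_neg h)
  | cons e l =>
    rw [sList_cons, ← mul_assoc, (isGEFamily D R).P_mul_S, if_neg, zero_mul]
    rwa [D.rng_smul, hl.1]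

/-- Moving `f` past the first edge turns it into `φ(f, e)`, by `s_{f·e,φ(f,e)} = s_{f·e,1}
p_{s(f·e),φ(f,e)}`; the induction continues with `φ(f, e)` on the tail, as in the recursive
definition of the action and the cocycle. -/
theorem p_mul_sList {v : V} {l : List Ed} (hl : D.IsPath v l) (f g : G) :
    p D R (f • v) f * sList D R v l g = sList D R (f • v) (D.actL f l) (D.cocL f l * g) := by
  induction l generalizing v f with
  | nil => exact ((isGEFamily D R).P_mul_P (f • v) f v g).trans (if_pos rfl)
  | cons e l ih =>
    rw [sList_cons, ← mul_assoc, (isGEFamily D R).P_mul_S, if_pos (by rw [D.rng_smul, hl.1]),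
      mul_one, ← s_mul_p_src, mul_assoc, actL, cocL, sList_cons, D.src_smul, ← D.φ_smul f e,
      ih hl.2]

theorem sList_append (v : V) (l : List Ed) {m : List Ed} (hm : D.IsPath (D.endpoint v l) m)
    (g : G) : sList D R v (l ++ m) g = sList D R v l 1 * sList D R (D.endpoint v l) m g := by
  induction l generalizing v with
  | nil =>
    have := p_mul_sList (R := R) hm 1 g
    simp only [one_smul, actL_one, cocL_one, one_mul] at this
    exact this.symm
  | cons e l ih => rw [List.cons_append, sList_cons, sList_cons, mul_assoc, endpoint, ih _ hm]

variable (R) in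
/-- The element `s_{α,g} s_{β,1}^*` for `s = (α, g, β)`. -/
def ofTriple (s : Triple D) : ExelPardoAlgebra D R :=
  sPath R s.a s.g * star (sPath R s.b 1)

open Triple Submodule

/-- Insert `p_{s(β),1} = ∑ s_e s_e^*` between the two factors; the summand of `e` is the element of
the restriction `(α(g·e), φ(g, e), βe)`. Membership in the span is all that is needed later, so the
sum is not recorded. -/
theorem ofTriple_mem_span_succ (t : Triple D) : ofTriple R t ∈ span R (ofTriple R ''
    {u | u.Restricts t ∧ u.b.length = t.b.length + 1}) := by
  have hb : star (sPath R t.b 1) = p D R t.b.s 1 * star (sPath R t.b 1) := by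
    have h := congrArg star (sList_one_mul_p (D := D) (R := R) t.b.r t.b.edges 1)
    rw [star_mul, (isGEFamily D R).star_P, inv_one, one_smul] at h
    exact h.symm
  rw [ofTriple, hb, (isGEFamily D R).isEFamily.sum, Finset.sum_mul, Finset.mul_sum]
  refine sum_mem fun e he => subset_span ?_
  replace he : t.b.s = D.rng e := ((Set.Finite.mem_toFinset _).1 he).symm
  let u : Triple D :=
    { a := t.a.append ((FinPath.edge D e).act t.g) (by rw [t.h, he]; rfl)
      g := D.φ t.g e
      b := t.b.append (.edge D e) he
      h := by
        refine (FinPath.s_append _ _ _).trans ((FinPath.s_act _ _).trans ?_)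
        rw [← D.φ_smul t.g e]
        exact congrArg _ (FinPath.s_append _ _ _).symm }
  refine ⟨u, ⟨⟨[e], rfl, rfl, rfl, rfl, rfl⟩, by simp [u, FinPath.length, FinPath.append,
    FinPath.edge]⟩, ?_⟩
  have h1 : sPath R u.b 1 = sPath R t.b 1 * s D R e 1 :=
    have hp : D.IsPath (D.endpoint t.b.r t.b.edges) [e] := ⟨he.symm, trivial⟩
    sList_append _ _ hp _
  -- Write `s_{α,g} = s_{α,1} p_{s(α),g}` and use `p_{s(α),g} s_{e,1} = s_{g·e,φ(g,e)}`, which is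
  -- valid because `r(g·e) = g · s(β) = s(α)`.
  have h2 : sPath R u.a u.g = sPath R t.a t.g * s D R e 1 := by
    have hp : D.IsPath (D.endpoint t.a.r t.a.edges) [t.g • e] :=
      ⟨by rw [D.rng_smul, ← he]; exact t.h.symm, trivial⟩
    have hs : p D R t.a.s t.g * s D R e 1 = s D R (t.g • e) (D.φ t.g e) := by
      rw [(isGEFamily D R).P_mul_S, if_pos (by rw [D.rng_smul, ← he, t.h]), mul_one]
    refine (sList_append _ _ hp _).trans ?_
    change sPath R t.a 1 * s D R (t.g • e) (D.φ t.g e) = _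
    rw [← hs, ← mul_assoc]
    exact congrArg (· * _) (sList_one_mul_p _ _ _)
  rw [ofTriple, h1, h2, star_mul]
  simp only [mul_assoc]

theorem ofTriple_mem_span (s : Triple D) {n : ℕ} (hn : s.b.length ≤ n) :
    ofTriple R s ∈ span R (ofTriple R '' {u | u.Restricts s ∧ u.b.length = n}) := by
  induction n, hn using Nat.le_induction with
  | base => exact subset_span ⟨s, ⟨.refl s, rfl⟩, rfl⟩
  | succ n _ ih =>
    refine span_le.2 ?_ ih
    rintro _ ⟨u, ⟨hu, rfl⟩, rfl⟩
    refine span_mono (Set.image_mono ?_) (ofTriple_mem_span_succ u)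
    exact fun v hv => ⟨hv.1.trans hu, hv.2⟩

theorem p_mul_ofTriple_mem (v : V) (f : G) (t : Triple D) :
    p D R v f * ofTriple R t ∈ span R (Set.range (ofTriple (D := D) R)) := by
  rw [ofTriple, ← mul_assoc, sPath]
  by_cases hv : v = f • t.a.r
  · subst hv
    rw [p_mul_sList t.a.isPath]
    exact subset_span ⟨⟨t.a.act f, t.a.coc f * t.g, t.b, by
      rw [FinPath.s_act, mul_smul, FinPath.coc_smul, t.h]⟩, rfl⟩
  · rw [p_mul_sList_of_ne t.a.isPath _ hv, zero_mul]
    exact zero_mem _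

theorem s_mul_ofTriple_mem (e : Ed) (t : Triple D) :
    s D R e 1 * ofTriple R t ∈ span R (Set.range (ofTriple (D := D) R)) := by
  rw [ofTriple, ← mul_assoc, sPath]
  by_cases hv : D.src e = t.a.r
  · rw [← hv, ← sList_cons (D.rng e)]
    exact subset_span ⟨⟨(FinPath.edge D e).append t.a hv, t.g, t.b, 
      (FinPath.s_append _ _ _).trans t.h⟩, rfl⟩
  · rw [← s_mul_p_src, mul_assoc (s D R e 1), p_mul_sList_of_ne t.a.isPath _ (by simpa using hv),
      mul_zero, zero_mul]
    exact zero_mem _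

/-- If the first entry is a vertex, `s_e^*` has no edge to act on. After one expansion every first
entry has positive length, and `s_e^*` either removes its first edge or annihilates the term. -/
theorem star_s_mul_ofTriple_mem (e : Ed) (t : Triple D) :
    star (s D R e 1) * ofTriple R t ∈ span R (Set.range (ofTriple (D := D) R)) := by
  have key := mem_map_of_mem (f := LinearMap.mulLeft R (star (s D R e 1)))
    (ofTriple_mem_span_succ (R := R) t)
  rw [map_span] at key
  refine span_le.2 ?_ key
  rintro _ ⟨_, ⟨u, ⟨⟨w, -, ha, -, -, hb⟩, hu⟩, rfl⟩, rfl⟩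
  -- The third entry has become longer by one edge; since the action preserves the length of `w`,
  -- the first entry is also nonempty.
  have hw : w ≠ [] := by
    rintro rfl
    simp [FinPath.length, hb] at hu
  obtain ⟨f, w, rfl⟩ := List.exists_cons_of_ne_nil hw
  obtain ⟨e', l, hl⟩ : ∃ e' l, u.a.edges = e' :: l :=
    List.exists_cons_of_ne_nil (by rw [ha]; simp [actL])
  have hp := u.a.isPath
  rw [hl] at hp
  change star (s D R e 1) * ofTriple R u ∈ _
  rw [ofTriple, sPath, hl, sList_cons, ← mul_assoc, ← mul_assoc]
  by_cases he : e = e'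
  · subst he
    have h1 := p_mul_sList (R := R) hp.2 1 u.g
    simp only [one_smul, actL_one, cocL_one, one_mul] at h1
    rw [(isGEFamily D R).isEFamily.star_mul_self, h1]
    have hs : u.a.s = D.endpoint (D.src e) l := by
      rw [FinPath.s, hl, endpoint]
    exact subset_span ⟨⟨⟨D.src e, l, hp.2⟩, u.g, u.b, hs.symm.trans u.h⟩, rfl⟩
  · rw [(isGEFamily D R).isEFamily.star_mul_of_ne e e' he, zero_mul, zero_mul]
    exact zero_mem _

theorem mul_mem_of_ofTriple {M : Submodule R (ExelPardoAlgebra D R)} {a : ExelPardoAlgebra D R}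
    (h : ∀ t, a * ofTriple R t ∈ M) {x : ExelPardoAlgebra D R}
    (hx : x ∈ span R (Set.range (ofTriple (D := D) R))) : a * x ∈ M := by
  have : span R (Set.range (ofTriple (D := D) R)) ≤ M.comap (LinearMap.mulLeft R a) :=
    span_le.2 (by rintro _ ⟨t, rfl⟩; exact h t)
  exact this hx

theorem ofTriple_ofVertex (v : V) (f : G) : ofTriple R (ofVertex D v f) = p D R v f := by
  change p D R v f * star (p D R (f⁻¹ • v) 1) = _
  rw [(isGEFamily D R).isEFamily.star_proj]
  simpa using (isGEFamily D R).P_mul_P v f (f⁻¹ • v) 1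

theorem ofTriple_ofEdge (e : Ed) (g : G) : ofTriple R (ofEdge D e g) = s D R e g := by
  change s D R e g * star (p D R (g⁻¹ • D.src e) 1) = _
  rw [(isGEFamily D R).isEFamily.star_proj]
  simpa using (isGEFamily D R).S_mul_P e g (g⁻¹ • D.src e) 1

theorem star_s (e : Ed) (g : G) :
    star (s D R e g) = p D R (g⁻¹ • D.src e) g⁻¹ * star (s D R e 1) := by
  rw [← s_mul_p_src, star_mul, (isGEFamily D R).star_P]

variable (D R) in
-- Left multiplication by `p_{v,f}`, `s_{e,1}` and `s_{e,1}^*` preserves the span, and all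
-- generators and their adjoints are built from these. Induction on formal expressions then extends
-- this to every element.
theorem span_range_ofTriple : span R (Set.range (ofTriple (D := D) R)) = ⊤ := by
  set M := span R (Set.range (ofTriple (D := D) R))
  let mk : Term G V Ed R → ExelPardoAlgebra D R := Quot.mk _
  have mem : ∀ t, ofTriple R t ∈ M := fun t => subset_span ⟨t, rfl⟩
  have hp : ∀ v f x, x ∈ M → p D R v f * x ∈ M := fun v f x hx =>
    mul_mem_of_ofTriple (p_mul_ofTriple_mem v f) hx
  have hs : ∀ e x, x ∈ M → s D R e 1 * x ∈ M := fun e x hx =>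
    mul_mem_of_ofTriple (s_mul_ofTriple_mem e) hx
  have hs' : ∀ e x, x ∈ M → star (s D R e 1) * x ∈ M := fun e x hx =>
    mul_mem_of_ofTriple (star_s_mul_ofTriple_mem e) hx
  -- Both membership and stability under left multiplication are claimed, each for the element and
  -- its adjoint: a product needs stability for its left factor, and the adjoint reverses products.
  suffices h : ∀ a, (mk a ∈ M ∧ star (mk a) ∈ M) ∧
      ∀ x ∈ M, mk a * x ∈ M ∧ star (mk a) * x ∈ M from
    eq_top_iff.2 (by rintro ⟨a⟩ -; exact (h a).1.1)
  intro a
  induction a with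
  | p v f =>
    change (p D R v f ∈ M ∧ star (p D R v f) ∈ M) ∧
      ∀ x ∈ M, p D R v f * x ∈ M ∧ star (p D R v f) * x ∈ M
    rw [(isGEFamily D R).star_P]
    have h : ∀ v f, p D R v f ∈ M := fun v f => ofTriple_ofVertex (R := R) (D := D) v f ▸ mem _
    exact ⟨⟨h _ _, h _ _⟩, fun x hx => ⟨hp _ _ _ hx, hp _ _ _ hx⟩⟩
  | s e g =>
    change (s D R e g ∈ M ∧ star (s D R e g) ∈ M) ∧
      ∀ x ∈ M, s D R e g * x ∈ M ∧ star (s D R e g) * x ∈ M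
    refine ⟨⟨ofTriple_ofEdge (R := R) (D := D) e g ▸ mem _, ?_⟩, fun x hx => ⟨?_, ?_⟩⟩
    -- The adjoint of `s_{e,g}` belongs to the adjoint triple `(g⁻¹ · s(e), g⁻¹, e)`.
    · have h := mem ⟨.vertex D (g⁻¹ • D.src e), g⁻¹, .edge D e, rfl⟩
      rw [star_s]
      exact h
    · rw [← s_mul_p_src, mul_assoc]
      exact hs _ _ (hp _ _ _ hx)
    · rw [star_s, mul_assoc]
      exact hp _ _ _ (hs' _ _ hx)
  | zero =>
    change ((0 : ExelPardoAlgebra D R) ∈ M ∧ star (0 : ExelPardoAlgebra D R) ∈ M) ∧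
      ∀ x ∈ M, 0 * x ∈ M ∧ star 0 * x ∈ M
    simp
  | add a b ha hb =>
    change (mk a + mk b ∈ M ∧ star (mk a + mk b) ∈ M) ∧
      ∀ x ∈ M, (mk a + mk b) * x ∈ M ∧ star (mk a + mk b) * x ∈ M
    simp only [star_add, add_mul]
    exact ⟨⟨add_mem ha.1.1 hb.1.1, add_mem ha.1.2 hb.1.2⟩, fun x hx =>
      ⟨add_mem (ha.2 x hx).1 (hb.2 x hx).1, add_mem (ha.2 x hx).2 (hb.2 x hx).2⟩⟩
  | neg a ha =>
    change (-mk a ∈ M ∧ star (-mk a) ∈ M) ∧ ∀ x ∈ M, -mk a * x ∈ M ∧ star (-mk a) * x ∈ M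
    simpa only [star_neg, neg_mul, neg_mem_iff] using ha
  | mul a b ha hb =>
    change (mk a * mk b ∈ M ∧ star (mk a * mk b) ∈ M) ∧
      ∀ x ∈ M, mk a * mk b * x ∈ M ∧ star (mk a * mk b) * x ∈ M
    simp only [star_mul, mul_assoc]
    exact ⟨⟨(ha.2 _ hb.1.1).1, (hb.2 _ ha.1.2).2⟩, fun x hx =>
      ⟨(ha.2 _ (hb.2 x hx).1).1, (hb.2 _ (ha.2 x hx).2).2⟩⟩
  | smul r a ha =>
    change (r • mk a ∈ M ∧ star (r • mk a) ∈ M) ∧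
      ∀ x ∈ M, r • mk a * x ∈ M ∧ star (r • mk a) * x ∈ M
    simp only [star_smul, smul_mul_assoc]
    exact ⟨⟨smul_mem _ _ ha.1.1, smul_mem _ _ ha.1.2⟩, fun x hx =>
      ⟨smul_mem _ _ (ha.2 x hx).1, smul_mem _ _ (ha.2 x hx).2⟩⟩
  | adj a ha =>
    change (star (mk a) ∈ M ∧ star (star (mk a)) ∈ M) ∧
      ∀ x ∈ M, star (mk a) * x ∈ M ∧ star (star (mk a)) * x ∈ M
    rw [star_star]
    exact ⟨ha.1.symm, fun x hx => (ha.2 x hx).symm⟩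

/-- In the Hausdorff case each element is a combination of elements `s_{α,g} s_{β,1}^*` with
pairwise disjoint sets of germs. -/
theorem exists_mem_span_of_pairwiseDisjoint [T2Space (Germ D)] (x : ExelPardoAlgebra D R) :
    ∃ W : Set (Triple D), W.PairwiseDisjoint Germ.theta ∧ x ∈ span R (ofTriple R '' W) := by
  have hx : x ∈ span R (Set.range (ofTriple (D := D) R)) := by
    rw [span_range_ofTriple]
    trivial
  obtain ⟨c, rfl⟩ := Finsupp.mem_span_range_iff_exists_finsupp.1 hx
  -- Expanding every triple in the support to the common length `N` leaves only restrictions with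
  -- pairwise disjoint germ sets.
  obtain ⟨N, hN, hd⟩ := Germ.exists_length c.support.finite_toSet
  refine ⟨_, hd, sum_mem fun t ht => smul_mem _ _ ?_⟩
  refine span_mono (Set.image_mono ?_) (ofTriple_mem_span t (hN t ht))
  exact fun u hu => ⟨hu.2, t, ht, hu.1⟩

end ExelPardoAlgebra

end

end ExelPardo

/-! ### The homomorphism `π` and its bijectivity -/

namespace ExelPardo

section

variable {G V Ed : Type*} [Group G] [MulAction G V] [MulAction G Ed]
  {D : SelfSimilarGraph G V Ed} {R : Type*} [CommRing R] [StarRing R]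

open SelfSimilarGraph Triple SteinbergAlgebra

namespace ExelPardoAlgebra

variable (D R) in
/-- The `*`-homomorphism `π_{G,E}` from `L_R(G, E)` to the Steinberg algebra. -/
noncomputable def toSteinberg : ExelPardoAlgebra D R →⋆ₙₐ[R] SteinbergAlgebra D R :=
  (existsUnique_hom D R (SteinbergAlgebra.isGEFamily D R)).choose

theorem toSteinberg_p (v : V) (f : G) :
    toSteinberg D R (p D R v f) = ofSGE R (.of (ofVertex D v f)) :=
  (existsUnique_hom D R (SteinbergAlgebra.isGEFamily D R)).choose_spec.1.1 v f

theorem toSteinberg_s (e : Ed) (g : G) :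
    toSteinberg D R (s D R e g) = ofSGE R (.of (ofEdge D e g)) :=
  (existsUnique_hom D R (SteinbergAlgebra.isGEFamily D R)).choose_spec.1.2 e g

theorem toSteinberg_sPath (α : FinPath D) (g : G) : toSteinberg D R (sPath R α g) =
    ofSGE R (.of ⟨α, g, .vertex D (g⁻¹ • α.s), (smul_inv_smul g α.s).symm⟩) := by
  obtain ⟨v, l, hl⟩ := α
  induction l generalizing v with
  | nil => exact toSteinberg_p v g
  | cons e l ih =>
    have h := ih (D.src e) hl.2
    change toSteinberg D R (sList D R (D.src e) l g) = _ at h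
    change toSteinberg D R (sList D R v (e :: l) g) = _
    rw [sList_cons, map_mul, h, toSteinberg_s, ofSGE_mul]
    refine congrArg _ (of_mul_eq l ?_ rfl hl.1.symm ?_ ?_ rfl)
    · simp [ofEdge, FinPath.vertex]
    · simp [ofEdge, FinPath.edge]
    · simp [ofEdge]

/-- In `S_{G,E}` one has `(α, g, β) = (α, g, s(β))(β, 1, s(β))^*`, where `s(β) = g⁻¹ · s(α)`. -/
theorem toSteinberg_ofTriple (t : Triple D) :
    toSteinberg D R (ofTriple R t) = ofSGE R (.of t) := by
  rw [ofTriple, map_mul, map_star, toSteinberg_sPath, toSteinberg_sPath, star_ofSGE, ofSGE_mul]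
  have hs : t.b.s = t.g⁻¹ • t.a.s := by rw [t.h, inv_smul_smul]
  refine congrArg _ (of_mul_eq [] ?_ rfl rfl ?_ ?_ rfl)
  · simp [Triple.adj, FinPath.vertex, hs]
  · simp [actL]
  · simp [Triple.adj, cocL]

/-- An element of the kernel is a combination over triples with disjoint germ sets. Its image takes
the value `c u` at any germ in `Θ_u`, and such a germ exists because `Θ_u` is nonempty; so all
coefficients vanish. -/
theorem toSteinberg_injective [T2Space (Germ D)] : Function.Injective (toSteinberg D R) := by
  classical
  refine (injective_iff_map_eq_zero _).2 fun x hx => ?_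
  obtain ⟨W, hW, hxW⟩ := exists_mem_span_of_pairwiseDisjoint x
  obtain ⟨c, hc, rfl⟩ := (Finsupp.mem_span_image_iff_linearCombination R).1 hxW
  suffices h : c = 0 by rw [h, map_zero]
  rw [Finsupp.linearCombination_apply, Finsupp.sum, map_sum] at hx
  simp only [map_smul, toSteinberg_ofTriple] at hx
  ext u
  by_contra hu
  replace hu : u ∈ c.support := Finsupp.mem_support_iff.2 hu
  obtain ⟨b, hb⟩ := Germ.theta_nonempty u
  have h := congrFun (congrArg (toFunₗ (R := R) (D := D)) hx) b
  rw [map_sum, Finset.sum_apply, Finset.sum_eq_single u] at h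
  · refine Finsupp.mem_support_iff.1 hu ?_
    change c u * (Germ.theta u).indicator 1 b = 0 at h
    rwa [Set.indicator_of_mem hb, Pi.one_apply, mul_one] at h
  · intro v hv hvu
    change c v * (Germ.theta v).indicator 1 b = 0
    rw [Set.indicator_of_notMem, mul_zero]
    exact fun hbv => Set.disjoint_left.1 (hW (hc hv) (hc hu) hvu) hbv hb
  · exact fun h => (h hu).elim

theorem toSteinberg_sum {U : Set (Germ D)} (hU : Germ.IsCompactOpenBisection U)
    (J : Finset (Triple D)) (hd : (J : Set (Triple D)).PairwiseDisjoint Germ.theta)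
    (h : U = ⋃ s ∈ J, Germ.theta s) :
    toSteinberg D R (∑ s ∈ J, ofTriple R s) = char R U hU := by
  rw [char_eq_sum hU J hd h, map_sum]
  exact Finset.sum_congr rfl fun s _ => toSteinberg_ofTriple s

/-- The functions `1_U` span the Steinberg algebra, and each is a finite sum of functions `1_{Θ_s}`,
which are images of the elements `s_{α,g} s_{β,1}^*`. -/
theorem toSteinberg_surjective [T2Space (Germ D)] : Function.Surjective (toSteinberg D R) := by
  rintro ⟨f, hf⟩
  let π : ExelPardoAlgebra D R →ₗ[R] SteinbergAlgebra D R :=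
    { toFun := toSteinberg D R
      map_add' := map_add (toSteinberg D R)
      map_smul' := map_smul (toSteinberg D R) }
  -- The range is taken among all functions on the groupoid, where `steinbergModule` is defined as a
  -- span, so that it suffices to test generators.
  let N : Submodule R (Germ D → R) := (toFunₗ ∘ₗ π).range
  have h : Germ.steinbergModule D R ≤ N := by
    refine Submodule.span_le.2 ?_
    rintro _ ⟨U, hU, rfl⟩
    obtain ⟨J, hd, hJ⟩ := Germ.exists_finset_eq_iUnion_theta hU
    exact ⟨_, congrArg toFunₗ (toSteinberg_sum hU J hd hJ)⟩
  obtain ⟨x, hx⟩ := h hf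
  exact ⟨x, Subtype.ext hx⟩

end ExelPardoAlgebra

end

end ExelPardo

/-! ### The isomorphism and the family `t_U` -/

open ExelPardo in
theorem theoremB {G V Ed R : Type*} [Group G] [Countable G] [Countable V] [Countable Ed]
    [MulAction G V] [MulAction G Ed] [CommRing R] [StarRing R] (D : SelfSimilarGraph G V Ed)
    (hausdorff : T2Space (Germ D)) :
    ∃ π : ExelPardoAlgebra D R ≃⋆ₐ[R] SteinbergAlgebra D R,
      -- the values of `π` on the generators
      (∀ (v : V) (f : G), π (ExelPardoAlgebra.p D R v f) =
        SteinbergAlgebra.char R (Germ.theta (Triple.ofVertex D v f))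
          (Germ.isCompactOpenBisection_theta _)) ∧
      (∀ (e : Ed) (g : G), π (ExelPardoAlgebra.s D R e g) =
        SteinbergAlgebra.char R (Germ.theta (Triple.ofEdge D e g))
          (Germ.isCompactOpenBisection_theta _)) ∧
      -- `π` is the only `*`-homomorphism with these values
      (∀ π' : ExelPardoAlgebra D R →⋆ₙₐ[R] SteinbergAlgebra D R,
        (∀ (v : V) (f : G), π' (ExelPardoAlgebra.p D R v f) =
          SteinbergAlgebra.char R (Germ.theta (Triple.ofVertex D v f))
            (Germ.isCompactOpenBisection_theta _)) →
        (∀ (e : Ed) (g : G), π' (ExelPardoAlgebra.s D R e g) =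
          SteinbergAlgebra.char R (Germ.theta (Triple.ofEdge D e g))
            (Germ.isCompactOpenBisection_theta _)) →
        ∀ a, π' a = π a) ∧
      -- the inverse of `π` is `1_U ↦ t_U` for a representation `t` of the compact open bisections
      ∃ t : {U : Set (Germ D) // Germ.IsCompactOpenBisection U} → ExelPardoAlgebra D R,
        IsRepresentation t ∧
        (∀ (U : {U : Set (Germ D) // Germ.IsCompactOpenBisection U}) (J : Finset (Triple D)),
          (J : Set (Triple D)).PairwiseDisjoint Germ.theta → U.1 = ⋃ s ∈ J, Germ.theta s →
          t U = ∑ s ∈ J, ExelPardoAlgebra.sPath R s.a s.g *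
            star (ExelPardoAlgebra.sPath R s.b 1)) ∧
        ∀ U, π.symm (SteinbergAlgebra.char R U.1 U.2) = t U := by
  let π : ExelPardoAlgebra D R ≃⋆ₐ[R] SteinbergAlgebra D R :=
    StarAlgEquiv.ofBijective (ExelPardoAlgebra.toSteinberg D R)
      ⟨ExelPardoAlgebra.toSteinberg_injective, ExelPardoAlgebra.toSteinberg_surjective⟩
  -- Taking `t_U = π⁻¹(1_U)` makes the formula for the inverse hold by definition. The relations of
  -- a representation are pulled back from indicator functions, and independence of the
  -- decomposition `J` comes for free.
  refine ⟨π, ExelPardoAlgebra.toSteinberg_p, ExelPardoAlgebra.toSteinberg_s, ?_,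
    fun U => π.symm (SteinbergAlgebra.char R U.1 U.2), ⟨?_, ?_, ?_⟩, ?_, fun _ => rfl⟩
  · intro π' hp hs a
    exact DFunLike.congr_fun ((ExelPardoAlgebra.existsUnique_hom D R
      (SteinbergAlgebra.isGEFamily D R)).unique ⟨hp, hs⟩
      ⟨ExelPardoAlgebra.toSteinberg_p, ExelPardoAlgebra.toSteinberg_s⟩) a
  · intro U hU
    rw [SteinbergAlgebra.char_eq_zero hU, map_zero]
  · intro U W
    rw [← map_mul, SteinbergAlgebra.char_mul]
  · intro U W T hd h
    rw [← map_add, SteinbergAlgebra.char_union U.2 W.2 T.2 hd h]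
  · intro U J hd h
    exact (congrArg π.symm (ExelPardoAlgebra.toSteinberg_sum U.2 J hd h)).symm.trans
      (π.symm_apply_apply _)
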